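/- **Setting.** Let $(\mathcal S,\mathcal A,P,c,\gamma)$ be a finite Markov decision process with nonempty $\mathcal S,\mathcal A$, costs $c(s,a)\in[0,1]$, $\gamma\in(0,1)$; put $\mathcal Z=\mathcal S\times\mathcal A$, $M=\frac1{1-\gamma}$. For a stationary randomized policy $\pi$ let $V^\pi,Q^\pi$ be its discounted value and state-action value functions, $f(\pi)=\mathbb E_{s\sim\vartheta}V^\pi(s)$ with $\vartheta$ any distribution on $\mathcal S$, and let $\pi^*$ be an optimal policy. A deterministic optimal policy takes in each state $s$ an action $a_s^{\pi^*}$ minimizing $Q^*(s,\cdot)=\min_\pi Q^\pi(s,\cdot)$; $\overline\Pi^*$ is the set of these. **Divergence.** $w$ is strictly convex on the simplex $\Delta_{\mathcal A}$ and differentiable (relative to the simplex) on its relative interior; $D^{p}_{q}=w(p)-w(q)-\langle\nabla w(q),p-q\rangle$ for $p\in\Delta_{\mathcal A}$ and $q$ in the relative interior, and $D^\pi_{\pi'}(s)=D^{\pi(\cdot|s)}_{\pi'(\cdot|s)}$. Let $\mu,\mathcal D>0$. Condition 1: (i) $D^p_q\ge\frac\mu2\|p-q\|_1^2$; (ii)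 for every $q$ in the relative interior, $\eta\ge0$ and $v\in\mathbb R^{\mathcal A}$, the minimum of $\eta\langle v,p\rangle+D^p_q$ over $p\in\Delta_{\mathcal A}$ is attained in the relative interior; (iii) there is $\tau(\mathcal D)>0$ such that for every state $s$, every policy $\pi$ in the relative interior and every $\pi^*\in\overline\Pi^*$, $(1-\gamma)D^{\pi^*}_\pi(s)\le\mathcal D$ implies $\pi(a^{\pi^*}_s|s)\ge\tau(\mathcal D)$. **Algorithm (SPMD with multi-trajectory TOMC).** Start from a policy $\pi_0$ in the relative interior (e.g. the uniform policy). At iteration $t=0,\dots,k-1$ sample $m$ trajectories of length $n$ of state-action pairs that, given the past and their arbitrary initial pairs, are independent Markov chains under $\pi_t$. For each trajectory $Z_0,\dots,Z_{n-1}$ and each $z=(s,a)$ let $\hat Q(z)=\sum_{j=\tau(z)}^{n-1}\gamma^{j-\tau(z)}c(Z_j)$, where $\tau(z)$ is the first $j\le n-1$ with $Z_j=z$ ($\hat Q(z)=0$ if there is none). Let $Q^{\pi_t,\xi_t}(s,a)$ be the average of the $m$ values $\hat Q(s,a)$ if $\pi_t(a|s)\ge\tau$, and $\frac1{1-\gamma}$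 otherwise. Update $\pi_{t+1}(\cdot|s)=\operatorname{argmin}_{p\in\Delta_{\mathcal A}}\eta\langle Q^{\pi_t,\xi_t}(s,\cdot),p\rangle+D^p_{\pi_t(\cdot|s)}$ for all $s$. **Mixing assumption.** There are constants $C\ge1$, $\rho\in(0,1)$, $\underline\nu\in(0,1]$ such that almost surely, for each generated policy $\pi=\pi_t$, $t<k$, the state chain has a stationary distribution $\nu^\pi\ge\underline\nu$ with $\sum_s|\mathbb P^{\pi}(S_t=s\mid S_0=s_0)-\nu^\pi(s)|\le C\rho^{t+1}$ for all $s_0$ and $t\ge0$. **Theorem.** Let $\delta\in(0,1)$ and $\mathcal D\ge2\max_{s}\max_{\pi^*\in\overline\Pi^*}D^{\pi^*}_{\pi_0}(s)$. Put $\tau=\min\{\tau(\mathcal D),1/|\mathcal A|\}$, $$H=\tfrac1{1-\gamma}+\tfrac{\lceil\log_\rho(\underline\nu\tau/(2C))\rceil}{\underline\nu\tau},\quad \eta=\tfrac12\sqrt{\tfrac{\mathcal D\mu}{kM^2}},\quad \varepsilon_k=\tfrac M2\sqrt{\tfrac{\mathcal D}{\mu k}},$$ $$X_m=\tfrac{|\mathcal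 A|^2}{(1-\gamma)^2\varepsilon_k^2}\log\tfrac{2|\mathcal Z|k}{\delta},\qquad X_n=H\log\tfrac{|\mathcal A|}{\varepsilon_k}\,(1+\log H).$$ There is a universal constant $c_0>0$, and for each $c_1\ge c_0$ a constant $K>0$ depending only on $c_1$, such that the following hold. 1. For every $k\ge1$ and all $m,n\ge1$ with $m\ge c_0X_m$, $n\ge c_0X_n$, with probability at least $1-\delta$, $$\min_{0\le t\le k-1}f(\pi_t)-f(\pi^*)\le\tfrac{3M}{1-\gamma}\sqrt{\tfrac{\mathcal D}{\mu k}}.$$ 2. Let $0<\epsilon\le\frac1{1-\gamma}$ with $\frac{9M^2\mathcal D}{\mu(1-\gamma)^2\epsilon^2}\ge1$, let $k=\big\lceil\frac{9M^2\mathcal D}{\mu(1-\gamma)^2\epsilon^2}\big\rceil$, and let $m,n$ be integers with $c_0X_m\le m\le\lceil c_1X_m\rceil$, $c_0X_n\le n\le\lceil c_1X_n\rceil$. Then $\min_{0\le t\le k-1}f(\pi_t)-f(\pi^*)\le\epsilon$ with probability at least $1-\delta$, and the total number of samples satisfies $$k\,m\,n\le K\,\tfrac{\mathcal D|\mathcal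 A|^2}{(1-\gamma)^8\mu\epsilon^4}\,H\,\log\Big(\tfrac{18|\mathcal Z|M^2\mathcal D}{\delta(1-\gamma)^2\mu\epsilon^2}\Big)\max\big\{1,\log\tfrac{|\mathcal A|}{\epsilon}\big\}\,(1+\log H)^2 .$$ -/

import Mathlib

open MeasureTheory

universe u v w

noncomputable section

namespace PolicyMD

/-- A finite discounted Markov decision process with costs in `[0,1]`;
`P s a s'` is the probability of moving to `s'` when action `a` is taken in state `s`. -/
structure MDP (S : Type u) (A : Type v) [Fintype S] where
  P : S → A → S → ℝ
  P_nonneg : ∀ s a s', 0 ≤ P s a s'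
  P_sum : ∀ s a, ∑ s', P s a s' = 1
  c : S → A → ℝ
  c_nonneg : ∀ s a, 0 ≤ c s a
  c_le_one : ∀ s a, c s a ≤ 1
  γ : ℝ
  γ_pos : 0 < γ
  γ_lt_one : γ < 1

/-- Relative interior of the probability simplex. -/
def openSimplex (A : Type v) [Fintype A] : Set (A → ℝ) :=
  {p | p ∈ stdSimplex ℝ A ∧ ∀ a, 0 < p a}

/-- `π` is a randomized stationary policy; `π s a` is the probability of `a` in state `s`. -/
def IsPolicy {S : Type u} {A : Type v} [Fintype A] (π : S → A → ℝ) : Prop :=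
  ∀ s, π s ∈ stdSimplex ℝ A

/-- `π` lies in the relative interior of the set of policies. -/
def IsInteriorPolicy {S : Type u} {A : Type v} [Fintype A] (π : S → A → ℝ) : Prop :=
  ∀ s, π s ∈ openSimplex A

section MDPNotions

variable {S : Type u} {A : Type v} [Fintype S] [Fintype A] [DecidableEq S] [DecidableEq A]

/-- Transition matrix of the state chain of the policy `π`. -/
def stateChain (M : MDP S A) (π : S → A → ℝ) : Matrix S S ℝ :=
  fun s s' => ∑ a, π s a * M.P s a s'

/-- Transition matrix of the chain of state-action pairs of the policy `π`. -/
def pairChain (M : MDP S A) (π : S → A → ℝ) : Matrix (S × A) (S × A) ℝ :=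
  fun z z' => M.P z.1 z.2 z'.1 * π z'.1 z'.2

/-- Value function: expected discounted cost from `S_0 = s`. -/
def valueV (M : MDP S A) (π : S → A → ℝ) (s : S) : ℝ :=
  ∑' t : ℕ, M.γ ^ t * ∑ s', ∑ a', ((stateChain M π) ^ t) s s' * π s' a' * M.c s' a'

/-- State-action value function: expected discounted cost from `(S_0, A_0) = (s, a)`. -/
def valueQ (M : MDP S A) (π : S → A → ℝ) (s : S) (a : A) : ℝ :=
  ∑' t : ℕ, M.γ ^ t * ∑ z : S × A, ((pairChain M π) ^ t) (s, a) z * M.c z.1 z.2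

/-- The objective `f(π)`, the mean of the value function under the state distribution `θ`. -/
def objective (M : MDP S A) (θ : S → ℝ) (π : S → A → ℝ) : ℝ :=
  ∑ s, θ s * valueV M π s

def IsOptimalPolicy (M : MDP S A) (π : S → A → ℝ) : Prop :=
  IsPolicy π ∧ ∀ π' : S → A → ℝ, IsPolicy π' → ∀ s, valueV M π s ≤ valueV M π' s

/-- Optimal state-action value function, the minimum of `Q^π(s,a)` over all policies. -/
def optQ (M : MDP S A) (s : S) (a : A) : ℝ :=
  ⨅ π : {π : S → A → ℝ // IsPolicy π}, valueQ M π.1 s a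

/-- The deterministic policy taking action `α s` in state `s`. -/
def detPolicy (α : S → A) : S → A → ℝ :=
  fun s => Pi.single (α s) 1

/-- `α` picks a minimizer of `Q^*(s, ·)` in every state: `detPolicy α` is then a
deterministic optimal policy, and all deterministic optimal policies have this form. -/
def IsOptimalSelector (M : MDP S A) (α : S → A) : Prop :=
  ∀ s b, optQ M s (α s) ≤ optQ M s b

/-- The state chain of `π` mixes geometrically, with constants `C, ρ`, to a stationary
distribution bounded below by `νmin`. -/
def MixesUniformly (M : MDP S A) (π : S → A → ℝ) (C ρ νmin : ℝ) : Prop :=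
  ∃ ν : S → ℝ, ν ∈ stdSimplex ℝ S ∧ (∀ s, ν s = ∑ s', ν s' * stateChain M π s' s) ∧
    (∀ s₀ (t : ℕ), ∑ s, |((stateChain M π) ^ t) s₀ s - ν s| ≤ C * ρ ^ (t + 1)) ∧
    ∀ s, νmin ≤ ν s

end MDPNotions

section Bregman

variable {A : Type v} [Fintype A]

/-- `w` is a strictly convex function on the simplex, differentiable (relative to the simplex)
at every point `q` of the relative interior, with gradient `g q`. -/
structure IsDistanceGenerating (w : (A → ℝ) → ℝ) (g : (A → ℝ) → A → ℝ) : Prop where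
  strictConvex : StrictConvexOn ℝ (stdSimplex ℝ A) w
  gradient : ∀ q ∈ openSimplex A,
    HasFDerivWithinAt w (∑ a, g q a • (ContinuousLinearMap.proj a : (A → ℝ) →L[ℝ] ℝ))
      (stdSimplex ℝ A) q

/-- Bregman divergence of `p` from `q`. -/
def bregman (w : (A → ℝ) → ℝ) (g : (A → ℝ) → A → ℝ) (p q : A → ℝ) : ℝ :=
  w p - w q - ∑ a, g q a * (p a - q a)

/-- `p` minimizes `η ⟨v, p⟩ + D(p, q)` over the simplex. -/
def IsMirrorStep (w : (A → ℝ) → ℝ) (g : (A → ℝ) → A → ℝ) (η : ℝ) (v q p : A → ℝ) : Prop :=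
  p ∈ stdSimplex ℝ A ∧
    IsMinOn (fun x : A → ℝ => η * ∑ a, v a * x a + bregman w g x q) (stdSimplex ℝ A) p

/-- The argmin of the mirror descent step. -/
def mirrorStep (w : (A → ℝ) → ℝ) (g : (A → ℝ) → A → ℝ) (η : ℝ) (v q : A → ℝ) : A → ℝ :=
  Classical.epsilon (IsMirrorStep w g η v q)

end Bregman

section Algorithm

variable {S : Type u} {A : Type v} [Fintype S] [Fintype A] [DecidableEq S] [DecidableEq A]

/-- The three requirements on the Bregman divergence: strong convexity in the `ℓ₁` norm with
modulus `μ`; updates from interior policies are attained at interior policies; and a divergence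
at most `D / (1 - γ)` from a deterministic optimal policy to an interior policy in a state
forces that policy to play the optimal action there with probability at least `τD`. -/
structure DivergenceCondition (M : MDP S A) (w : (A → ℝ) → ℝ) (g : (A → ℝ) → A → ℝ)
    (μ D τD : ℝ) : Prop where
  strong_convex : ∀ p ∈ stdSimplex ℝ A, ∀ q ∈ openSimplex A,
    μ / 2 * (∑ a, |p a - q a|) ^ 2 ≤ bregman w g p q
  interior : ∀ q ∈ openSimplex A, ∀ (η : ℝ), 0 ≤ η → ∀ v : A → ℝ,
    ∃ p ∈ openSimplex A, IsMirrorStep w g η v q p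
  threshold_pos : 0 < τD
  threshold : ∀ (s : S) (π : S → A → ℝ), IsInteriorPolicy π → ∀ α : S → A,
    IsOptimalSelector M α →
    (1 - M.γ) * bregman w g (detPolicy α s) (π s) ≤ D → τD ≤ π s (α s)

/-- First time `t < n` at which the trajectory `ζ` visits `z`, and `n` if there is none. -/
def hitTime (n : ℕ) (ζ : ℕ → S × A) (z : S × A) : ℕ :=
  sInf {t | t = n ∨ (t < n ∧ ζ t = z)}

/-- Discounted cost collected by `ζ_0, …, ζ_{n-1}` from its first visit of `z` on
(zero if `z` is not visited). -/
def omcSingle (M : MDP S A) (n : ℕ) (ζ : ℕ → S × A) (z : S × A) : ℝ :=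
  ∑ t ∈ Finset.Ico (hitTime n ζ z) n, M.γ ^ (t - hitTime n ζ z) * M.c (ζ t).1 (ζ t).2

/-- On-policy Monte Carlo estimate from the `m` trajectories `ξ 0, …, ξ (m-1)` of length `n`. -/
def omc (M : MDP S A) (m n : ℕ) (ξ : ℕ → ℕ → S × A) (s : S) (a : A) : ℝ :=
  (1 / (m : ℝ)) * ∑ l ∈ Finset.range m, omcSingle M n (ξ l) (s, a)

/-- Truncated on-policy Monte Carlo estimate. -/
def tomc (M : MDP S A) (m n : ℕ) (τ : ℝ) (π : S → A → ℝ) (ξ : ℕ → ℕ → S × A)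
    (s : S) (a : A) : ℝ :=
  if τ ≤ π s a then omc M m n ξ s a else 1 / (1 - M.γ)

/-- The policies generated by SPMD with the TOMC operator from the samples `x`; `x t l j` is the
`j`-th state-action pair of the `l`-th trajectory of iteration `t`. -/
def spmdPolicy (M : MDP S A) (w : (A → ℝ) → ℝ) (g : (A → ℝ) → A → ℝ) (η τ : ℝ) (m n : ℕ)
    (π₀ : S → A → ℝ) (x : ℕ → ℕ → ℕ → S × A) : ℕ → S → A → ℝ
  | 0 => π₀
  | t + 1 => fun s =>
      mirrorStep w g η (tomc M m n τ (spmdPolicy M w g η τ m n π₀ x t) (x t) s)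
        (spmdPolicy M w g η τ m n π₀ x t s)

/-- The random samples `Z t l j` (iteration `t < k`, trajectory `l < m`, time `j < n`) are
collected on-policy: given the samples of the earlier iterations and the (arbitrary) initial
pairs of the `m` trajectories of iteration `t`, these trajectories are independent Markov chains
with the transition matrix induced by the current policy. -/
structure IsSPMDRun (M : MDP S A) (w : (A → ℝ) → ℝ) (g : (A → ℝ) → A → ℝ) (η τ : ℝ)
    (k m n : ℕ) (π₀ : S → A → ℝ) {Ω : Type w} [MeasurableSpace Ω] (ℙ : Measure Ω)
    (Z : ℕ → ℕ → ℕ → Ω → S × A) : Prop where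
  measurable : ∀ t l j z, MeasurableSet {ω | Z t l j ω = z}
  law : ∀ t < k, ∀ x : ℕ → ℕ → ℕ → S × A,
    ℙ.real {ω | (∀ i < t, ∀ l < m, ∀ j < n, Z i l j ω = x i l j) ∧
        ∀ l < m, ∀ j < n, Z t l j ω = x t l j} =
      ℙ.real {ω | (∀ i < t, ∀ l < m, ∀ j < n, Z i l j ω = x i l j) ∧
        ∀ l < m, Z t l 0 ω = x t l 0} *
      ∏ l ∈ Finset.range m, ∏ j ∈ Finset.range (n - 1),
        pairChain M (spmdPolicy M w g η τ m n π₀ x t) (x t l j) (x t l (j + 1))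

/-- The (random) policy `π_t` of a run. -/
def runPolicy (M : MDP S A) (w : (A → ℝ) → ℝ) (g : (A → ℝ) → A → ℝ) (η τ : ℝ) (m n : ℕ)
    (π₀ : S → A → ℝ) {Ω : Type w} (Z : ℕ → ℕ → ℕ → Ω → S × A) (t : ℕ) (ω : Ω) : S → A → ℝ :=
  spmdPolicy M w g η τ m n π₀ (fun i l j => Z i l j ω) t

/-- `f(π̂_k)`, the smallest objective value among the iterates `π_0, …, π_{k-1}`. -/
def bestValue (M : MDP S A) (θ : S → ℝ) (k : ℕ) (hk : 0 < k) (π : ℕ → S → A → ℝ) : ℝ :=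
  (Finset.range k).inf' (Finset.nonempty_range_iff.mpr hk.ne') (fun t => objective M θ (π t))

end Algorithm

/-- The bracket `1/(1-γ) + ⌈log_ρ(νmin τ / (2C))⌉ / (νmin τ)`. -/
def mixFactor (γ C ρ νmin τ : ℝ) : ℝ :=
  1 / (1 - γ) + (⌈Real.logb ρ (νmin * τ / (2 * C))⌉ : ℝ) / (νmin * τ)

/-- The scale of the number `m` of trajectories; `a = |A|`, `z = |S × A|`. -/
def mScale (γ a z k δ ε : ℝ) : ℝ :=
  a ^ 2 / ((1 - γ) ^ 2 * ε ^ 2) * Real.log (2 * z * k / δ)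

/-- The scale of the trajectory length `n`, with `1 + log H` the hidden logarithmic factor. -/
def nScale (H a ε : ℝ) : ℝ :=
  H * Real.log (a / ε) * (1 + Real.log H)

/-- The sample complexity bound, with `(1 + log H) ^ 2` the hidden logarithmic factor. -/
def sampleBound (γ H a z D μ δ ε : ℝ) : ℝ :=
  D * a ^ 2 / ((1 - γ) ^ 8 * μ * ε ^ 4) * H *
    Real.log (18 * z * (1 / (1 - γ)) ^ 2 * D / (δ * (1 - γ) ^ 2 * μ * ε ^ 2)) *
    max 1 (Real.log (a / ε)) * (1 + Real.log H) ^ 2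

end PolicyMD

end

set_option linter.unusedSectionVars false

/-! Fix a deterministic optimal policy π* with state chain P*, and let N = ∑ γ^t (P*)^t. The
performance difference lemma writes V^{π_t}(s) - V^{π*}(s) as an N-weighted sum over states of
⟨Q^{π_t}, π_t - π*⟩, and the mirror step bounds each such product, times η, by a drop of the
divergence D^{π*}_{π_t} plus a small error. Hence Φ_t(s) = (1-γ) ∑ N(s,s') D^{π*}_{π_t}(s') is a
potential: Φ_{t+1} + η(1-γ)(V^{π_t} - V^{π*}) ≤ Φ_t + B. Telescoping bounds the sum of the gaps,
hence the best iterate.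

The estimates are reliable only for actions of probability at least τ; elsewhere they are replaced
by 1/(1-γ), an upper bound of Q. This costs nothing as long as the optimal action is not truncated:
a truncated action then has π* = 0, and overestimating its cost only increases ⟨v, π_t - π*⟩. The
proviso maintains itself. The potential starts below D/2, the errors add at most D/2 in total, and
the gaps are nonnegative, so Φ_t ≤ D throughout; since N(s,s) ≥ 1, also (1-γ) D^{π*}_{π_t}(s) ≤ D,
and the threshold condition keeps the optimal action above τ. This induction is `sum_gap_le`.

Accuracy above the threshold holds with high probability. The bias of one trajectory is at most
1/(1-γ) times the mean of γ^(n-T), with T the first visit of the pair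
(`abs_pathExp_omcSingle_sub_le`). Mixing forces a visit with probability at least νmin τ / 2 in each
block of about one mixing time, so the bias decays geometrically (`hitDiscount_le_of_nScale_le`).
Given the past, the policy is fixed and the trajectories are independent, so a Chernoff bound
applies on each fibre of the past (`measureReal_deviation_le`); a union bound over iterations and
pairs finishes. The sample count is then arithmetic. -/

namespace PolicyMD

/-- A row-stochastic matrix. -/
structure IsStochastic {ι : Type*} [Fintype ι] (P : Matrix ι ι ℝ) : Prop where
  nonneg : ∀ i j, 0 ≤ P i j
  sum_eq_one : ∀ i, ∑ j, P i j = 1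

/-! ### Discounted occupancy of a stochastic matrix -/

section Resolvent

variable {ι : Type*} [Fintype ι] [DecidableEq ι] {P : Matrix ι ι ℝ} {γ : ℝ}

theorem IsStochastic.pow (hP : IsStochastic P) (t : ℕ) : IsStochastic (P ^ t) := by
  induction t with
  | zero =>
    refine ⟨fun i j => ?_, fun i => ?_⟩
    · simp only [pow_zero, Matrix.one_apply]; split_ifs <;> norm_num
    · simp [Matrix.one_apply]
  | succ t ih =>
    refine ⟨fun i j => ?_, fun i => ?_⟩
    · rw [pow_succ, Matrix.mul_apply]
      exact Finset.sum_nonneg fun l _ => mul_nonneg (ih.nonneg i l) (hP.nonneg l j)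
    · simp only [pow_succ, Matrix.mul_apply]
      rw [Finset.sum_comm]
      simp [← Finset.mul_sum, hP.sum_eq_one, ih.sum_eq_one]

theorem IsStochastic.le_one (hP : IsStochastic P) (i j : ι) : P i j ≤ 1 := by
  rw [← hP.sum_eq_one i]
  exact Finset.single_le_sum (fun l _ => hP.nonneg i l) (Finset.mem_univ j)

/-- The discounted occupancy `∑ t, γ ^ t * P ^ t`. -/
noncomputable def resolvent (γ : ℝ) (P : Matrix ι ι ℝ) (i j : ι) : ℝ :=
  ∑' t : ℕ, γ ^ t * (P ^ t) i j

theorem summable_resolvent (hP : IsStochastic P) (h0 : 0 < γ) (h1 : γ < 1) (i j : ι) :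
    Summable fun t : ℕ => γ ^ t * (P ^ t) i j := by
  refine Summable.of_nonneg_of_le
    (fun t => mul_nonneg (pow_nonneg h0.le t) ((hP.pow t).nonneg i j))
    (fun t => mul_le_of_le_one_right (pow_nonneg h0.le t) ((hP.pow t).le_one i j))
    (summable_geometric_of_lt_one h0.le h1)

theorem resolvent_nonneg (hP : IsStochastic P) (h0 : 0 < γ) (i j : ι) :
    0 ≤ resolvent γ P i j :=
  tsum_nonneg fun t => mul_nonneg (pow_nonneg h0.le t) ((hP.pow t).nonneg i j)

/-- The time-zero term alone is 1. This is what makes the potential of `sum_gap_le` dominate the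
divergence in every single state. -/
theorem one_le_resolvent_self (hP : IsStochastic P) (h0 : 0 < γ) (h1 : γ < 1) (i : ι) :
    1 ≤ resolvent γ P i i := by
  have := (summable_resolvent hP h0 h1 i i).le_tsum 0
    (fun t _ => mul_nonneg (pow_nonneg h0.le t) ((hP.pow t).nonneg i i))
  simpa [resolvent] using this

theorem sum_resolvent (hP : IsStochastic P) (h0 : 0 < γ) (h1 : γ < 1) (i : ι) :
    ∑ j, resolvent γ P i j = (1 - γ)⁻¹ := by
  unfold resolvent
  rw [← Summable.tsum_finsetSum fun j _ => summable_resolvent hP h0 h1 i j]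
  simp_rw [← Finset.mul_sum, (hP.pow _).sum_eq_one, mul_one]
  exact tsum_geometric_of_lt_one h0.le h1

theorem tsum_mul_eq_sum_resolvent (hP : IsStochastic P) (h0 : 0 < γ) (h1 : γ < 1) (f : ι → ℝ)
    (i : ι) : ∑' t : ℕ, γ ^ t * ∑ j, (P ^ t) i j * f j = ∑ j, resolvent γ P i j * f j := by
  unfold resolvent
  simp_rw [← tsum_mul_right]
  rw [← Summable.tsum_finsetSum fun j _ => (summable_resolvent hP h0 h1 i j).mul_right (f j)]
  simp_rw [Finset.mul_sum, mul_assoc]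

theorem resolvent_eq_left (hP : IsStochastic P) (h0 : 0 < γ) (h1 : γ < 1) (i j : ι) :
    resolvent γ P i j = (1 : Matrix ι ι ℝ) i j + γ * ∑ l, P i l * resolvent γ P l j := by
  conv_lhs => rw [resolvent, (summable_resolvent hP h0 h1 i j).tsum_eq_zero_add]
  simp only [pow_zero, one_mul]
  congr 1
  simp only [resolvent, ← tsum_mul_left]
  rw [← Summable.tsum_finsetSum fun l _ => (summable_resolvent hP h0 h1 l j).mul_left (P i l),
    ← tsum_mul_left]
  refine tsum_congr fun t => ?_
  rw [pow_succ' P, Matrix.mul_apply, Finset.mul_sum, Finset.mul_sum]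
  exact Finset.sum_congr rfl fun l _ => by ring

theorem resolvent_eq_right (hP : IsStochastic P) (h0 : 0 < γ) (h1 : γ < 1) (i j : ι) :
    resolvent γ P i j = (1 : Matrix ι ι ℝ) i j + γ * ∑ l, resolvent γ P i l * P l j := by
  conv_lhs => rw [resolvent, (summable_resolvent hP h0 h1 i j).tsum_eq_zero_add]
  simp only [pow_zero, one_mul]
  congr 1
  simp only [resolvent, ← tsum_mul_right]
  rw [← Summable.tsum_finsetSum fun l _ => (summable_resolvent hP h0 h1 i l).mul_right (P l j),
    ← tsum_mul_left]
  refine tsum_congr fun t => ?_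
  rw [pow_succ P, Matrix.mul_apply, Finset.mul_sum, Finset.mul_sum]
  exact Finset.sum_congr rfl fun l _ => by ring

/-- From N = I + γ N P, the resolvent N is a left inverse of I - γP. Consequently Bellman equations
have unique solutions, and any function is recovered from its Bellman residual. -/
theorem eq_sum_resolvent (hP : IsStochastic P) (h0 : 0 < γ) (h1 : γ < 1) (f : ι → ℝ) (i : ι) :
    f i = ∑ j, resolvent γ P i j * (f j - γ * ∑ l, P j l * f l) := by
  have h : ∑ j, resolvent γ P i j * f j =
      f i + ∑ j, resolvent γ P i j * (γ * ∑ l, P j l * f l) := by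
    have e : ∀ j, resolvent γ P i j * f j =
        (1 : Matrix ι ι ℝ) i j * f j + γ * ∑ l, resolvent γ P i l * P l j * f j := fun j => by
      conv_lhs => rw [resolvent_eq_right hP h0 h1 i j, add_mul, mul_assoc, Finset.sum_mul]
    simp_rw [e, Finset.sum_add_distrib]
    congr 1
    · simp [Matrix.one_apply]
    · rw [← Finset.mul_sum, Finset.sum_comm, Finset.mul_sum]
      refine Finset.sum_congr rfl fun l _ => ?_
      rw [Finset.mul_sum, Finset.mul_sum, Finset.mul_sum]
      exact Finset.sum_congr rfl fun j _ => by ring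
  simp_rw [mul_sub, Finset.sum_sub_distrib]
  linarith

theorem sum_resolvent_bellman (hP : IsStochastic P) (h0 : 0 < γ) (h1 : γ < 1) (f : ι → ℝ)
    (i : ι) : ∑ j, resolvent γ P i j * f j =
      f i + γ * ∑ l, P i l * ∑ j, resolvent γ P l j * f j := by
  have e : ∀ j, resolvent γ P i j * f j =
      (1 : Matrix ι ι ℝ) i j * f j + γ * ∑ l, P i l * resolvent γ P l j * f j := fun j => by
    conv_lhs => rw [resolvent_eq_left hP h0 h1 i j, add_mul, mul_assoc, Finset.sum_mul]
  simp_rw [e, Finset.sum_add_distrib]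
  congr 1
  · simp [Matrix.one_apply]
  · rw [← Finset.mul_sum, Finset.sum_comm]
    congr 1
    refine Finset.sum_congr rfl fun l _ => ?_
    rw [Finset.mul_sum]
    exact Finset.sum_congr rfl fun j _ => by ring

theorem eq_sum_resolvent_of_bellman (hP : IsStochastic P) (h0 : 0 < γ) (h1 : γ < 1)
    {f c : ι → ℝ} (h : ∀ i, f i = c i + γ * ∑ l, P i l * f l) (i : ι) :
    f i = ∑ j, resolvent γ P i j * c j := by
  rw [eq_sum_resolvent hP h0 h1 f i]
  exact Finset.sum_congr rfl fun j _ => by rw [sub_eq_of_eq_add (h j)]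

theorem sum_resolvent_mul_mem (hP : IsStochastic P) (h0 : 0 < γ) (h1 : γ < 1) {c : ι → ℝ}
    (hc0 : ∀ i, 0 ≤ c i) (hc1 : ∀ i, c i ≤ 1) (i : ι) :
    0 ≤ ∑ j, resolvent γ P i j * c j ∧ ∑ j, resolvent γ P i j * c j ≤ (1 - γ)⁻¹ := by
  refine ⟨Finset.sum_nonneg fun j _ => mul_nonneg (resolvent_nonneg hP h0 i j) (hc0 j), ?_⟩
  rw [← sum_resolvent hP h0 h1 i]
  exact Finset.sum_le_sum fun j _ =>
    mul_le_of_le_one_right (resolvent_nonneg hP h0 i j) (hc1 j)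

end Resolvent

/-! ### Bellman equations, performance difference and greedy optimal policies -/

section Bellman

variable {S : Type u} {A : Type v} [Fintype S] [Fintype A] [DecidableEq S] [DecidableEq A]
  (M : MDP S A) {π π' : S → A → ℝ}

theorem isStochastic_stateChain (hπ : IsPolicy π) : IsStochastic (stateChain M π) := by
  refine ⟨fun s s' => Finset.sum_nonneg fun a _ => mul_nonneg ((hπ s).1 a) (M.P_nonneg s a s'),
    fun s => ?_⟩
  simp only [stateChain]
  rw [Finset.sum_comm]
  simp [← Finset.mul_sum, M.P_sum, (hπ s).2]

theorem isStochastic_pairChain (hπ : IsPolicy π) : IsStochastic (pairChain M π) := by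
  refine ⟨fun z z' => mul_nonneg (M.P_nonneg _ _ _) ((hπ _).1 _), fun z => ?_⟩
  simp only [pairChain]
  rw [Fintype.sum_prod_type]
  simp [← Finset.mul_sum, M.P_sum, (hπ _).2]

theorem valueV_eq (hπ : IsPolicy π) (s : S) :
    valueV M π s = ∑ s', resolvent M.γ (stateChain M π) s s' * ∑ a, π s' a * M.c s' a := by
  rw [← tsum_mul_eq_sum_resolvent (isStochastic_stateChain M hπ) M.γ_pos M.γ_lt_one]
  simp only [valueV, Finset.mul_sum, mul_assoc]

theorem valueQ_eq (hπ : IsPolicy π) (s : S) (a : A) :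
    valueQ M π s a = ∑ z, resolvent M.γ (pairChain M π) (s, a) z * M.c z.1 z.2 := by
  rw [← tsum_mul_eq_sum_resolvent (isStochastic_pairChain M hπ) M.γ_pos M.γ_lt_one]
  simp only [valueQ]

theorem valueV_bellman (hπ : IsPolicy π) (s : S) :
    valueV M π s = ∑ a, π s a * (M.c s a + M.γ * ∑ s', M.P s a s' * valueV M π s') := by
  have h := sum_resolvent_bellman (isStochastic_stateChain M hπ) M.γ_pos M.γ_lt_one
    (fun s' => ∑ a, π s' a * M.c s' a) s
  simp_rw [← valueV_eq M hπ] at h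
  rw [h]
  simp_rw [mul_add, Finset.sum_add_distrib]
  congr 1
  simp only [stateChain, Finset.mul_sum, Finset.sum_mul]
  rw [Finset.sum_comm]
  exact Finset.sum_congr rfl fun _ _ => Finset.sum_congr rfl fun _ _ => by ring

/-- The right side solves the Bellman equation of the pair chain, whose solution is unique. -/
theorem valueQ_eq_valueV (hπ : IsPolicy π) (s : S) (a : A) :
    valueQ M π s a = M.c s a + M.γ * ∑ s', M.P s a s' * valueV M π s' := by
  rw [valueQ_eq M hπ]
  refine (eq_sum_resolvent_of_bellman (isStochastic_pairChain M hπ) M.γ_pos M.γ_lt_one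
    (f := fun z => M.c z.1 z.2 + M.γ * ∑ s', M.P z.1 z.2 s' * valueV M π s')
    (c := fun z => M.c z.1 z.2) (fun z => ?_) (s, a)).symm
  congr 2
  rw [Fintype.sum_prod_type]
  refine Finset.sum_congr rfl fun s' _ => ?_
  rw [valueV_bellman M hπ s', Finset.mul_sum]
  exact Finset.sum_congr rfl fun b _ => by simp only [pairChain]; ring

theorem valueV_eq_sum_valueQ (hπ : IsPolicy π) (s : S) :
    valueV M π s = ∑ a, π s a * valueQ M π s a := by
  rw [valueV_bellman M hπ]
  exact Finset.sum_congr rfl fun a _ => by rw [valueQ_eq_valueV M hπ]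

theorem valueQ_bellman (hπ : IsPolicy π) (z : S × A) :
    valueQ M π z.1 z.2 =
      M.c z.1 z.2 + M.γ * ∑ z', pairChain M π z z' * valueQ M π z'.1 z'.2 := by
  rw [valueQ_eq_valueV M hπ, Fintype.sum_prod_type]
  congr 2
  refine Finset.sum_congr rfl fun s' _ => ?_
  rw [valueV_eq_sum_valueQ M hπ s', Finset.mul_sum]
  exact Finset.sum_congr rfl fun b _ => by simp only [pairChain]; ring

theorem valueQ_mem (hπ : IsPolicy π) (s : S) (a : A) :
    0 ≤ valueQ M π s a ∧ valueQ M π s a ≤ (1 - M.γ)⁻¹ := by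
  rw [valueQ_eq M hπ]
  exact sum_resolvent_mul_mem (isStochastic_pairChain M hπ) M.γ_pos M.γ_lt_one
    (fun z => M.c_nonneg _ _) (fun z => M.c_le_one _ _) _

theorem valueV_mem (hπ : IsPolicy π) (s : S) :
    0 ≤ valueV M π s ∧ valueV M π s ≤ (1 - M.γ)⁻¹ := by
  rw [valueV_eq M hπ]
  refine sum_resolvent_mul_mem (isStochastic_stateChain M hπ) M.γ_pos M.γ_lt_one
    (fun s => Finset.sum_nonneg fun a _ => mul_nonneg ((hπ s).1 a) (M.c_nonneg _ _))
    (fun s => ?_) _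
  rw [← (hπ s).2]
  exact Finset.sum_le_sum fun a _ => mul_le_of_le_one_right ((hπ s).1 a) (M.c_le_one _ _)

/-- Performance difference lemma. -/
theorem valueV_sub_valueV (hπ : IsPolicy π) (hπ' : IsPolicy π') (s : S) :
    valueV M π s - valueV M π' s =
      ∑ s', resolvent M.γ (stateChain M π') s s' *
        ∑ a, (π s' a - π' s' a) * valueQ M π s' a := by
  -- The difference of the value functions is expanded along the chain of π'; its Bellman residual
  -- there is the advantage term on the right.
  rw [eq_sum_resolvent (isStochastic_stateChain M hπ') M.γ_pos M.γ_lt_one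
    (fun s => valueV M π s - valueV M π' s) s]
  refine Finset.sum_congr rfl fun s' _ => ?_
  congr 1
  simp_rw [sub_mul, mul_sub, Finset.sum_sub_distrib]
  rw [← valueV_eq_sum_valueQ M hπ]
  have h1 : ∀ π₁ : S → A → ℝ, M.γ * ∑ l, stateChain M π' s' l * valueV M π₁ l =
      ∑ a, π' s' a * (M.γ * ∑ l, M.P s' a l * valueV M π₁ l) := fun π₁ => by
    simp only [stateChain, Finset.mul_sum, Finset.sum_mul]
    rw [Finset.sum_comm]
    exact Finset.sum_congr rfl fun _ _ => Finset.sum_congr rfl fun _ _ => by ring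
  have h2 : ∑ a, π' s' a * valueQ M π s' a = ∑ a, π' s' a * M.c s' a +
      ∑ a, π' s' a * (M.γ * ∑ l, M.P s' a l * valueV M π l) := by
    rw [← Finset.sum_add_distrib]
    exact Finset.sum_congr rfl fun a _ => by rw [valueQ_eq_valueV M hπ]; ring
  have h3 : valueV M π' s' = ∑ a, π' s' a * M.c s' a +
      ∑ a, π' s' a * (M.γ * ∑ l, M.P s' a l * valueV M π' l) := by
    rw [← Finset.sum_add_distrib, valueV_bellman M hπ']
    exact Finset.sum_congr rfl fun a _ => by ring
  rw [mul_sub, h1, h1]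
  linarith

theorem isPolicy_detPolicy (α : S → A) : IsPolicy (detPolicy α) :=
  fun s => single_mem_stdSimplex ℝ (α s)

theorem sum_detPolicy_mul (α : S → A) (s : S) (f : A → ℝ) :
    ∑ a, detPolicy α s a * f a = f (α s) := by
  simp [detPolicy, Pi.single_apply]

theorem optQ_eq (h : IsOptimalPolicy M π) (s : S) (a : A) : optQ M s a = valueQ M π s a := by
  have : Nonempty {π : S → A → ℝ // IsPolicy π} := ⟨⟨π, h.1⟩⟩
  refine le_antisymm (ciInf_le ⟨0, ?_⟩ (⟨π, h.1⟩ : {π : S → A → ℝ // IsPolicy π}))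
    (le_ciInf fun π' => ?_)
  · rintro _ ⟨π', rfl⟩
    exact (valueQ_mem M π'.2 s a).1
  · rw [valueQ_eq_valueV M h.1, valueQ_eq_valueV M π'.2]
    have := Finset.sum_le_sum fun s' (_ : s' ∈ Finset.univ) =>
      mul_le_mul_of_nonneg_left (h.2 π'.1 π'.2 s') (M.P_nonneg s a s')
    have := mul_le_mul_of_nonneg_left this M.γ_pos.le
    linarith

theorem exists_isOptimalSelector [Nonempty A] : ∃ α : S → A, IsOptimalSelector M α := by
  choose α hα using fun s => Finite.exists_min (optQ M s)
  exact ⟨α, hα⟩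

/-- An optimal policy has Q = Q*, so moving all its mass to minimizers of Q* makes every advantage
in the performance difference lemma favourable. -/
theorem IsOptimalSelector.isOptimalPolicy (h : IsOptimalPolicy M π) {α : S → A}
    (hα : IsOptimalSelector M α) : IsOptimalPolicy M (detPolicy α) := by
  refine ⟨isPolicy_detPolicy α, fun π' hπ' s => le_trans ?_ (h.2 π' hπ' s)⟩
  rw [← sub_nonneg, valueV_sub_valueV M h.1 (isPolicy_detPolicy α)]
  refine Finset.sum_nonneg fun s' _ => mul_nonneg
    (resolvent_nonneg (isStochastic_stateChain M (isPolicy_detPolicy α)) M.γ_pos _ _) ?_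
  simp_rw [sub_mul, Finset.sum_sub_distrib, sum_detPolicy_mul]
  rw [sub_nonneg]
  calc valueQ M π s' (α s') = ∑ a, π s' a * valueQ M π s' (α s') := by
        rw [← Finset.sum_mul, (h.1 s').2, one_mul]
    _ ≤ _ := Finset.sum_le_sum fun a _ => mul_le_mul_of_nonneg_left
        (by rw [← optQ_eq M h, ← optQ_eq M h]; exact hα s' a) ((h.1 s').1 a)

theorem objective_le (θ : S → ℝ) (hθ : θ ∈ stdSimplex ℝ S) (h : IsOptimalPolicy M π)
    (hπ' : IsPolicy π') : objective M θ π ≤ objective M θ π' :=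
  Finset.sum_le_sum fun s _ => mul_le_mul_of_nonneg_left (h.2 π' hπ' s) (hθ.1 s)

theorem objective_mem {θ : S → ℝ} (hθ : θ ∈ stdSimplex ℝ S) (hπ : IsPolicy π) :
    0 ≤ objective M θ π ∧ objective M θ π ≤ (1 - M.γ)⁻¹ := by
  refine ⟨Finset.sum_nonneg fun s _ => mul_nonneg (hθ.1 s) (valueV_mem M hπ s).1, ?_⟩
  calc objective M θ π ≤ ∑ s, θ s * (1 - M.γ)⁻¹ :=
        Finset.sum_le_sum fun s _ => mul_le_mul_of_nonneg_left (valueV_mem M hπ s).2 (hθ.1 s)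
    _ = _ := by rw [← Finset.sum_mul, hθ.2, one_mul]

end Bellman

end PolicyMD

namespace PolicyMD

/-! ### The mirror descent step in one state -/

section MirrorStep

variable {A : Type v} [Fintype A] {wgen : (A → ℝ) → ℝ} {grad : (A → ℝ) → A → ℝ}

theorem strictConvexOn_mirrorObjective (hw : IsDistanceGenerating wgen grad) (η : ℝ)
    (v q : A → ℝ) :
    StrictConvexOn ℝ (stdSimplex ℝ A)
      (fun x : A → ℝ => η * ∑ a, v a * x a + bregman wgen grad x q) := by
  refine ⟨convex_stdSimplex ℝ A, fun x hx y hy hxy a b ha hb hab => ?_⟩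
  have h := hw.strictConvex.2 hx hy hxy ha hb hab
  have e : ∀ f : A → ℝ, ∑ i, f i * (a • x + b • y) i =
      a * ∑ i, f i * x i + b * ∑ i, f i * y i := fun f => by
    simp only [Finset.mul_sum, ← Finset.sum_add_distrib]
    exact Finset.sum_congr rfl fun i _ => by
      simp only [Pi.add_apply, Pi.smul_apply, smul_eq_mul]; ring
  simp only [bregman, mul_sub, Finset.sum_sub_distrib, e, smul_eq_mul] at h ⊢
  have : b = 1 - a := by linarith
  subst this
  nlinarith

/-- Strict convexity makes the minimizer unique, so the choice made by `Classical.epsilon` is the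
interior point provided by the divergence condition. -/
theorem mirrorStep_spec (hw : IsDistanceGenerating wgen grad) {η : ℝ} {v q p : A → ℝ}
    (hp : p ∈ openSimplex A) (h : IsMirrorStep wgen grad η v q p) :
    mirrorStep wgen grad η v q = p := by
  have h' : IsMirrorStep wgen grad η v q (mirrorStep wgen grad η v q) :=
    Classical.epsilon_spec (⟨p, h⟩ : ∃ p, IsMirrorStep wgen grad η v q p)
  exact (strictConvexOn_mirrorObjective hw η v q).eq_of_isMinOn h'.2 h.2 h'.1 hp.1

/-- First-order condition along the segment from `p` to `x`. Interiority of `p` matters, since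
`grad` is a derivative of the generating function only there. -/
theorem mirrorStep_optimality (hw : IsDistanceGenerating wgen grad) {η : ℝ} {v q p x : A → ℝ}
    (hp : p ∈ openSimplex A) (h : IsMirrorStep wgen grad η v q p) (hx : x ∈ stdSimplex ℝ A) :
    0 ≤ ∑ a, (η * v a + grad p a - grad q a) * (x a - p a) := by
  have hd : HasFDerivWithinAt (fun x : A → ℝ => η * ∑ a, v a * x a + bregman wgen grad x q)
      (η • (∑ a, v a • (ContinuousLinearMap.proj a : (A → ℝ) →L[ℝ] ℝ)) +
        ((∑ a, grad p a • (ContinuousLinearMap.proj a : (A → ℝ) →L[ℝ] ℝ)) -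
        (∑ a, grad q a • (ContinuousLinearMap.proj a : (A → ℝ) →L[ℝ] ℝ))))
      (stdSimplex ℝ A) p := by
    have hlin : ∀ f : A → ℝ, HasFDerivWithinAt (fun x : A → ℝ => ∑ a, f a * x a)
        (∑ a, f a • (ContinuousLinearMap.proj a : (A → ℝ) →L[ℝ] ℝ)) (stdSimplex ℝ A) p :=
      fun f => by
        have := (∑ a, f a • (ContinuousLinearMap.proj a : (A → ℝ) →L[ℝ] ℝ)).hasFDerivWithinAt
          (s := stdSimplex ℝ A) (x := p)
        refine this.congr (fun y _ => by simp) (by simp)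
    have h2 := ((hlin v).const_mul η).add
      ((((hw.gradient p hp).sub_const (wgen q))).sub
        ((hlin (grad q)).sub_const (∑ a, grad q a * q a)))
    refine h2.congr (fun y _ => ?_) ?_ <;> simp [bregman, mul_sub, Finset.sum_sub_distrib]
  have := IsLocalMinOn.hasFDerivWithinAt_nonneg h.2.localize hd
    (sub_mem_posTangentConeAt_of_segment_subset
      ((convex_stdSimplex ℝ A).segment_subset hp.1 hx))
  simp only [add_apply, sub_apply,
    smul_apply, sum_apply, ContinuousLinearMap.proj_apply,
    smul_eq_mul, Pi.sub_apply] at this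
  convert this using 1
  rw [Finset.mul_sum, ← Finset.sum_sub_distrib, ← Finset.sum_add_distrib]
  exact Finset.sum_congr rfl fun a _ => by ring

/-- The optimality inequality rewritten through the three-point identity for Bregman divergences. -/
theorem three_point (hw : IsDistanceGenerating wgen grad) {η : ℝ} {v q p x : A → ℝ}
    (hp : p ∈ openSimplex A) (h : IsMirrorStep wgen grad η v q p) (hx : x ∈ stdSimplex ℝ A) :
    η * ∑ a, v a * (p a - x a) + bregman wgen grad p q ≤
      bregman wgen grad x q - bregman wgen grad x p := by
  have h1 := mirrorStep_optimality hw hp h hx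
  have e : ∑ a, (η * v a + grad p a - grad q a) * (x a - p a) =
      - (η * ∑ a, v a * (p a - x a)) + ∑ a, grad p a * (x a - p a)
        - (∑ a, grad q a * (x a - q a) - ∑ a, grad q a * (p a - q a)) := by
    rw [Finset.mul_sum, ← Finset.sum_neg_distrib, ← Finset.sum_add_distrib,
      ← Finset.sum_sub_distrib, ← Finset.sum_sub_distrib]
    exact Finset.sum_congr rfl fun a _ => by ring
  simp only [bregman]
  linarith

/-- One step of mirror descent with a bounded gradient `v`. -/
theorem mirror_descent_step (hw : IsDistanceGenerating wgen grad) {μ R η : ℝ} (hμ : 0 < μ)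
    (hη : 0 ≤ η)
    (hsc : ∀ p ∈ stdSimplex ℝ A, ∀ q ∈ openSimplex A,
      μ / 2 * (∑ a, |p a - q a|) ^ 2 ≤ bregman wgen grad p q)
    {v q p x : A → ℝ} (hq : q ∈ openSimplex A) (hp : p ∈ openSimplex A)
    (h : IsMirrorStep wgen grad η v q p) (hx : x ∈ stdSimplex ℝ A) (hv : ∀ a, |v a| ≤ R) :
    η * ∑ a, v a * (q a - x a) ≤
      bregman wgen grad x q - bregman wgen grad x p + η ^ 2 * R ^ 2 / (2 * μ) := by
  have h1 := three_point hw hp h hx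
  have h2 := hsc p hp.1 q hq
  set y := ∑ a, |p a - q a|
  have h3 : ∑ a, v a * (q a - p a) ≤ R * y := by
    rw [Finset.mul_sum]
    refine Finset.sum_le_sum fun a _ => (le_abs_self _).trans ?_
    rw [abs_mul, abs_sub_comm]
    exact mul_le_mul_of_nonneg_right (hv a) (abs_nonneg _)
  have h4 : ∑ a, v a * (q a - x a) =
      ∑ a, v a * (q a - p a) + ∑ a, v a * (p a - x a) := by
    rw [← Finset.sum_add_distrib]
    exact Finset.sum_congr rfl fun a _ => by ring
  -- Young's inequality: the linear loss is absorbed by the strong convexity term of the divergence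
  -- between consecutive iterates.
  have h5 : η * (R * y) ≤ μ / 2 * y ^ 2 + η ^ 2 * R ^ 2 / (2 * μ) := by
    have : μ / 2 * y ^ 2 + η ^ 2 * R ^ 2 / (2 * μ) - η * (R * y) =
        (μ * y - η * R) ^ 2 / (2 * μ) := by field_simp; ring
    have h6 : 0 ≤ (μ * y - η * R) ^ 2 / (2 * μ) := by positivity
    linarith
  have h7 := mul_le_mul_of_nonneg_left h3 hη
  rw [h4, mul_add]
  linarith

end MirrorStep

end PolicyMD

namespace PolicyMD

/-! ### Finite path expectations of a Markov chain -/

section Path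

variable {Z : Type*} [Fintype Z]

/-- The sequence starting at `z₀`, continuing with `r`, and constantly `d` afterwards. -/
def path {l : ℕ} (d z₀ : Z) (r : Fin l → Z) : ℕ → Z
  | 0 => z₀
  | j + 1 => if h : j < l then r ⟨j, h⟩ else d

/-- The sequence `z₀, ζ 0, ζ 1, …`. -/
def prepend (z₀ : Z) (ζ : ℕ → Z) : ℕ → Z
  | 0 => z₀
  | j + 1 => ζ j

theorem path_cons {l : ℕ} (d z₀ z₁ : Z) (r : Fin l → Z) :
    path d z₀ (Fin.cons z₁ r : Fin (l + 1) → Z) = prepend z₀ (path d z₁ r) := by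
  funext j
  rcases j with _ | _ | j
  · rfl
  · simp [path, prepend]
  · simp only [path, prepend, Nat.add_lt_add_iff_right]
    split_ifs with h
    · exact Fin.cons_succ (α := fun _ => Z) z₁ r ⟨j, h⟩
    · rfl

/-- Probability that the chain `P` follows `ζ` for `l` steps. -/
def pathWeight (P : Matrix Z Z ℝ) (l : ℕ) (ζ : ℕ → Z) : ℝ :=
  ∏ j ∈ Finset.range l, P (ζ j) (ζ (j + 1))

/-- Expectation of `F` over the first `l` steps of the chain `P` started at `z₀`. -/
def pathExp (P : Matrix Z Z ℝ) (d : Z) (l : ℕ) (z₀ : Z) (F : (ℕ → Z) → ℝ) : ℝ :=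
  ∑ r : Fin l → Z, pathWeight P l (path d z₀ r) * F (path d z₀ r)

variable (P : Matrix Z Z ℝ) (d : Z)

theorem pathWeight_succ (l : ℕ) (z₀ : Z) (ζ : ℕ → Z) :
    pathWeight P (l + 1) (prepend z₀ ζ) = P z₀ (ζ 0) * pathWeight P l ζ := by
  simp only [pathWeight, Finset.prod_range_succ']
  rw [mul_comm]; rfl

theorem pathExp_zero (z₀ : Z) (F : (ℕ → Z) → ℝ) :
    pathExp P d 0 z₀ F = F (path d z₀ (Fin.elim0 : Fin 0 → Z)) := by
  simp only [pathExp, pathWeight, Finset.range_zero, Finset.prod_empty, one_mul]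
  rw [Fintype.sum_unique]
  congr 2

/-- The Markov property at the first step; all later inductions on trajectory length run through it.
-/
theorem pathExp_succ (l : ℕ) (z₀ : Z) (F : (ℕ → Z) → ℝ) :
    pathExp P d (l + 1) z₀ F =
      ∑ z₁, P z₀ z₁ * pathExp P d l z₁ (fun ζ => F (prepend z₀ ζ)) := by
  simp only [pathExp]
  rw [← (Fin.consEquiv fun _ : Fin (l + 1) => Z).sum_comp, Fintype.sum_prod_type]
  refine Finset.sum_congr rfl fun z₁ _ => ?_
  rw [Finset.mul_sum]
  refine Finset.sum_congr rfl fun r _ => ?_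
  simp only [Fin.consEquiv, Equiv.coe_fn_mk]
  rw [path_cons, pathWeight_succ, mul_assoc]
  rfl

variable {P}

theorem pathWeight_nonneg (hP : IsStochastic P) (l : ℕ) (ζ : ℕ → Z) : 0 ≤ pathWeight P l ζ :=
  Finset.prod_nonneg fun _ _ => hP.nonneg _ _

theorem sum_pathWeight (hP : IsStochastic P) (l : ℕ) (z₀ : Z) :
    ∑ r : Fin l → Z, pathWeight P l (path d z₀ r) = 1 := by
  have : ∀ z₀, pathExp P d l z₀ (fun _ => 1) = 1 := by
    induction l with
    | zero => intro z₀; rw [pathExp_zero]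
    | succ l ih => intro z₀; rw [pathExp_succ]; simp [ih, hP.sum_eq_one]
  simpa [pathExp] using this z₀

theorem pathExp_const_add_mul (hP : IsStochastic P) (l : ℕ) (z₀ : Z) (a b : ℝ)
    (F : (ℕ → Z) → ℝ) :
    pathExp P d l z₀ (fun ζ => a + b * F ζ) = a + b * pathExp P d l z₀ F := by
  have := sum_pathWeight d hP l z₀
  simp only [pathExp, mul_add, Finset.sum_add_distrib, ← Finset.sum_mul]
  rw [this, one_mul, Finset.mul_sum]
  congr 1
  exact Finset.sum_congr rfl fun _ _ => by ring

end Path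

/-! ### First visit times -/

section HittingTime

variable {Z : Type*} [Fintype Z] [DecidableEq Z]

/-- The probability that the chain `P` from `z₀` does not visit `z` at the times `0, …, j - 1`. -/
def survival (P : Matrix Z Z ℝ) (z : Z) : ℕ → Z → ℝ
  | 0, _ => 1
  | j + 1, z₀ => if z₀ = z then 0 else ∑ z', P z₀ z' * survival P z j z'

/-- The expectation of `γ ^ (n - T)` for the first visit time `T` of `z`, stopped at `n`. -/
def hitDiscount (P : Matrix Z Z ℝ) (γ : ℝ) (z : Z) : ℕ → Z → ℝ
  | 0, _ => 1
  | n + 1, z₀ => if z₀ = z then γ ^ (n + 1) else ∑ z', P z₀ z' * hitDiscount P γ z n z'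

variable {P : Matrix Z Z ℝ} {γ : ℝ} (z : Z)

theorem IsStochastic.sum_mul_le (hP : IsStochastic P) {f : Z → ℝ} {b : ℝ} (hf : ∀ i, f i ≤ b)
    (i : Z) : ∑ j, P i j * f j ≤ b := by
  calc ∑ j, P i j * f j ≤ ∑ j, P i j * b :=
        Finset.sum_le_sum fun j _ => mul_le_mul_of_nonneg_left (hf j) (hP.nonneg i j)
    _ = b := by rw [← Finset.sum_mul, hP.sum_eq_one, one_mul]

theorem hitDiscount_le_one (hP : IsStochastic P) (h0 : 0 < γ) (h1 : γ < 1) (n : ℕ) (z₀ : Z) :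
    hitDiscount P γ z n z₀ ≤ 1 := by
  induction n generalizing z₀ with
  | zero => simp [hitDiscount]
  | succ n ih =>
    simp only [hitDiscount]
    split_ifs
    · exact pow_le_one₀ h0.le h1.le
    · exact hP.sum_mul_le ih z₀

/-- Either the visit occurs among the first `j` times, leaving at least `N` steps of discount, or it
does not, which is the survival event with discount at most 1. -/
theorem hitDiscount_le (hP : IsStochastic P) (h0 : 0 < γ) (h1 : γ < 1) (N j : ℕ) (z₀ : Z) :
    hitDiscount P γ z (N + j) z₀ ≤ γ ^ N + survival P z j z₀ := by
  induction j generalizing z₀ with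
  | zero =>
    have := hitDiscount_le_one z hP h0 h1 (N + 0) z₀
    have := pow_nonneg h0.le N
    simp only [survival]
    linarith
  | succ j ih =>
    rw [← add_assoc]
    simp only [hitDiscount, survival]
    split_ifs
    · rw [add_zero]
      exact pow_le_pow_of_le_one h0.le h1.le (by omega)
    · calc _ ≤ ∑ z', P z₀ z' * (γ ^ N + survival P z j z') :=
            Finset.sum_le_sum fun z' _ => mul_le_mul_of_nonneg_left (ih z') (hP.nonneg _ _)
        _ = _ := by
          simp_rw [mul_add, Finset.sum_add_distrib, ← Finset.sum_mul, hP.sum_eq_one, one_mul]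

/-- A path avoiding `z` at the times 0, …, j is in particular not at `z` at time j, which shifts the
index by one. -/
theorem survival_le_one_sub (hP : IsStochastic P) (j : ℕ) (z₀ : Z) :
    survival P z (j + 1) z₀ ≤ 1 - (P ^ j) z₀ z := by
  induction j generalizing z₀ with
  | zero => simp [survival, Matrix.one_apply, hP.sum_eq_one]; split_ifs <;> simp
  | succ j ih =>
    rw [survival]
    have h : ∑ z', P z₀ z' * survival P z (j + 1) z' ≤ 1 - (P ^ (j + 1)) z₀ z := by
      calc _ ≤ ∑ z', P z₀ z' * (1 - (P ^ j) z' z) :=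
            Finset.sum_le_sum fun z' _ => mul_le_mul_of_nonneg_left (ih z') (hP.nonneg _ _)
        _ = _ := by
          simp_rw [mul_sub, mul_one, Finset.sum_sub_distrib, hP.sum_eq_one]
          rw [pow_succ', Matrix.mul_apply]
    split_ifs
    · linarith [(hP.pow (j + 1)).le_one z₀ z]
    · exact h

/-- Markov property: whatever pair is reached after `j` steps, avoiding `z` for another `B` steps
has probability at most `b`. -/
theorem survival_add_le (hP : IsStochastic P) {B : ℕ} {b : ℝ}
    (hB : ∀ z₀, survival P z B z₀ ≤ b) (j : ℕ) (z₀ : Z) :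
    survival P z (j + B) z₀ ≤ b * survival P z j z₀ := by
  induction j generalizing z₀ with
  | zero => simpa [survival] using hB z₀
  | succ j ih =>
    rw [add_right_comm]
    simp only [survival]
    split_ifs
    · simp
    · rw [Finset.mul_sum]
      exact Finset.sum_le_sum fun z' _ =>
        (mul_le_mul_of_nonneg_left (ih z') (hP.nonneg _ _)).trans_eq (by ring)

theorem survival_mul_le (hP : IsStochastic P) {B : ℕ} {b : ℝ} (hb : 0 ≤ b)
    (hB : ∀ z₀, survival P z B z₀ ≤ b) (i : ℕ) (z₀ : Z) :
    survival P z (i * B) z₀ ≤ b ^ i := by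
  induction i generalizing z₀ with
  | zero => simp [survival]
  | succ i ih =>
    rw [add_mul, one_mul, pow_succ']
    exact (survival_add_le z hP hB _ _).trans (mul_le_mul_of_nonneg_left (ih z₀) hb)

end HittingTime

/-! ### Bias of the on-policy Monte Carlo estimate -/

section MonteCarlo

variable {S : Type u} {A : Type v} [Fintype S] [Fintype A] [DecidableEq S] [DecidableEq A]
  (M : MDP S A)

theorem hitTime_le (n : ℕ) (ζ : ℕ → S × A) (z : S × A) : hitTime n ζ z ≤ n :=
  Nat.sInf_le (Or.inl rfl)

theorem hitTime_zero (ζ : ℕ → S × A) (z : S × A) : hitTime 0 ζ z = 0 :=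
  Nat.le_zero.1 (hitTime_le 0 ζ z)

theorem hitTime_of_eq (n : ℕ) (ζ : ℕ → S × A) (z : S × A) (h : ζ 0 = z) :
    hitTime n ζ z = 0 := by
  rcases n with _ | n
  · exact hitTime_zero ζ z
  · exact Nat.le_zero.1 (Nat.sInf_le (Or.inr ⟨n.succ_pos, h⟩))

theorem hitTime_prepend (n : ℕ) (ζ : ℕ → S × A) (z₀ z : S × A) (h : z₀ ≠ z) :
    hitTime (n + 1) (prepend z₀ ζ) z = hitTime n ζ z + 1 := by
  have hne : {t | t = n ∨ (t < n ∧ ζ t = z)}.Nonempty := ⟨n, Or.inl rfl⟩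
  refine le_antisymm (Nat.sInf_le ?_) (le_csInf ⟨n + 1, Or.inl rfl⟩ ?_)
  · rcases Nat.sInf_mem hne with h1 | ⟨h1, h2⟩
    · exact Or.inl (congrArg (· + 1) h1)
    · exact Or.inr ⟨Nat.succ_lt_succ h1, h2⟩
  · rintro (_ | t) ht
    · rcases ht with ht | ⟨_, ht⟩
      · omega
      · exact absurd ht h
    · refine Nat.succ_le_succ (Nat.sInf_le ?_)
      rcases ht with ht | ⟨h1, h2⟩
      · exact Or.inl (by omega)
      · exact Or.inr ⟨by omega, h2⟩

theorem hitTime_congr {n : ℕ} {ζ ζ' : ℕ → S × A} (h : ∀ j < n, ζ j = ζ' j) (z : S × A) :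
    hitTime n ζ z = hitTime n ζ' z := by
  unfold hitTime
  congr 1
  ext t
  simp only [Set.mem_ofPred_eq]
  exact or_congr Iff.rfl (and_congr_right fun ht => by rw [h t ht])

theorem omcSingle_congr {n : ℕ} {ζ ζ' : ℕ → S × A} (h : ∀ j < n, ζ j = ζ' j) (z : S × A) :
    omcSingle M n ζ z = omcSingle M n ζ' z := by
  unfold omcSingle
  rw [hitTime_congr h z]
  exact Finset.sum_congr rfl fun t ht => by rw [h t (Finset.mem_Ico.1 ht).2]

theorem omcSingle_mem (n : ℕ) (ζ : ℕ → S × A) (z : S × A) :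
    0 ≤ omcSingle M n ζ z ∧ omcSingle M n ζ z ≤ (1 - M.γ)⁻¹ := by
  unfold omcSingle
  refine ⟨Finset.sum_nonneg fun t _ => mul_nonneg (pow_nonneg M.γ_pos.le _) (M.c_nonneg _ _), ?_⟩
  calc _ ≤ ∑ t ∈ Finset.Ico (hitTime n ζ z) n, M.γ ^ (t - hitTime n ζ z) :=
        Finset.sum_le_sum fun t _ =>
          mul_le_of_le_one_right (pow_nonneg M.γ_pos.le _) (M.c_le_one _ _)
    _ = ∑ i ∈ Finset.range (n - hitTime n ζ z), M.γ ^ i := by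
        rw [Finset.sum_Ico_eq_sum_range]; simp
    _ ≤ ∑' i : ℕ, M.γ ^ i := Summable.sum_le_tsum _ (fun i _ => pow_nonneg M.γ_pos.le i)
        (summable_geometric_of_lt_one M.γ_pos.le M.γ_lt_one)
    _ = _ := tsum_geometric_of_lt_one M.γ_pos.le M.γ_lt_one

theorem omc_mem {m : ℕ} (hm : 0 < m) (n : ℕ) (ξ : ℕ → ℕ → S × A) (s : S) (a : A) :
    0 ≤ omc M m n ξ s a ∧ omc M m n ξ s a ≤ (1 - M.γ)⁻¹ := by
  have hm' : (0 : ℝ) < m := Nat.cast_pos.2 hm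
  unfold omc
  refine ⟨mul_nonneg (by positivity)
    (Finset.sum_nonneg fun l _ => (omcSingle_mem M n (ξ l) (s, a)).1), ?_⟩
  calc _ ≤ 1 / (m : ℝ) * ∑ l ∈ Finset.range m, (1 - M.γ)⁻¹ :=
        mul_le_mul_of_nonneg_left
          (Finset.sum_le_sum fun l _ => (omcSingle_mem M n (ξ l) (s, a)).2) (by positivity)
    _ = _ := by simp; field_simp

theorem omc_congr {m n : ℕ} {ξ ξ' : ℕ → ℕ → S × A} (h : ∀ l < m, ∀ j < n, ξ l j = ξ' l j)
    (s : S) (a : A) : omc M m n ξ s a = omc M m n ξ' s a := by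
  unfold omc
  congr 1
  exact Finset.sum_congr rfl fun l hl => omcSingle_congr M (h l (Finset.mem_range.1 hl)) _

/-- Discounted cost of the first `n` pairs of a trajectory. -/
def truncatedCost (n : ℕ) (ζ : ℕ → S × A) : ℝ :=
  ∑ t ∈ Finset.range n, M.γ ^ t * M.c (ζ t).1 (ζ t).2

theorem truncatedCost_prepend (n : ℕ) (z₀ : S × A) (ζ : ℕ → S × A) :
    truncatedCost M (n + 1) (prepend z₀ ζ) =
      M.c z₀.1 z₀.2 + M.γ * truncatedCost M n ζ := by
  simp only [truncatedCost, Finset.sum_range_succ', Finset.mul_sum, prepend]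
  rw [add_comm]
  congr 1
  · simp
  · exact Finset.sum_congr rfl fun t _ => by ring

theorem omcSingle_of_eq (n : ℕ) (ζ : ℕ → S × A) (z : S × A) (h : ζ 0 = z) :
    omcSingle M n ζ z = truncatedCost M n ζ := by
  unfold omcSingle truncatedCost
  rw [hitTime_of_eq n ζ z h]
  simp

theorem omcSingle_prepend (n : ℕ) (z₀ z : S × A) (ζ : ℕ → S × A) (h : z₀ ≠ z) :
    omcSingle M (n + 1) (prepend z₀ ζ) z = omcSingle M n ζ z := by
  unfold omcSingle
  rw [hitTime_prepend n ζ z₀ z h, ← Finset.sum_Ico_add']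
  refine Finset.sum_congr rfl fun t _ => ?_
  rw [Nat.add_sub_add_right]
  rfl

variable {π : S → A → ℝ}

/-- Truncated and infinite costs obey the same one-step recursion, so each additional step contracts
the error by γ; with a single pair the error is already at most γ/(1-γ). -/
theorem abs_pathExp_truncatedCost_sub_le (hπ : IsPolicy π) (d : S × A) (l : ℕ) (z : S × A) :
    |pathExp (pairChain M π) d l z (truncatedCost M (l + 1)) - valueQ M π z.1 z.2| ≤
      (1 - M.γ)⁻¹ * M.γ ^ (l + 1) := by
  have hP := isStochastic_pairChain M hπ
  induction l generalizing z with
  | zero =>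
    rw [pathExp_zero, valueQ_bellman M hπ z]
    have h0 : 0 ≤ ∑ z', pairChain M π z z' * valueQ M π z'.1 z'.2 :=
      Finset.sum_nonneg fun z' _ => mul_nonneg (hP.nonneg _ _) (valueQ_mem M hπ _ _).1
    have h1 : ∑ z', pairChain M π z z' * valueQ M π z'.1 z'.2 ≤ (1 - M.γ)⁻¹ :=
      hP.sum_mul_le (fun z' => (valueQ_mem M hπ _ _).2) z
    have e : truncatedCost M (0 + 1) (path d z (Fin.elim0 : Fin 0 → S × A)) = M.c z.1 z.2 := by
      simp [truncatedCost, path]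
    rw [e, sub_add_cancel_left, abs_neg, abs_of_nonneg (mul_nonneg M.γ_pos.le h0)]
    nlinarith [M.γ_pos]
  | succ l ih =>
    rw [pathExp_succ, valueQ_bellman M hπ z]
    have e : ∑ z₁, pairChain M π z z₁ * pathExp (pairChain M π) d l z₁
        (fun ζ => truncatedCost M (l + 1 + 1) (prepend z ζ)) -
        (M.c z.1 z.2 + M.γ * ∑ z', pairChain M π z z' * valueQ M π z'.1 z'.2) =
        M.γ * ∑ z₁, pairChain M π z z₁ *
          (pathExp (pairChain M π) d l z₁ (truncatedCost M (l + 1)) - valueQ M π z₁.1 z₁.2) := by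
      simp_rw [truncatedCost_prepend, pathExp_const_add_mul d hP, mul_add, mul_sub,
        Finset.sum_add_distrib, Finset.sum_sub_distrib, ← Finset.sum_mul, hP.sum_eq_one, one_mul]
      rw [mul_sub, Finset.mul_sum (a := M.γ) (s := Finset.univ)
        (f := fun z₁ => pairChain M π z z₁ * pathExp _ _ _ _ _)]
      have : ∀ z₁, pairChain M π z z₁ * (M.γ * pathExp (pairChain M π) d l z₁
          (truncatedCost M (l + 1))) = M.γ * (pairChain M π z z₁ * pathExp (pairChain M π) d l z₁
          (truncatedCost M (l + 1))) := fun z₁ => by ring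
      simp_rw [this]
      ring
    rw [e, abs_mul, abs_of_pos M.γ_pos]
    have := calc
      |∑ z₁, pairChain M π z z₁ *
          (pathExp (pairChain M π) d l z₁ (truncatedCost M (l + 1)) - valueQ M π z₁.1 z₁.2)|
        ≤ ∑ z₁, pairChain M π z z₁ *
          |pathExp (pairChain M π) d l z₁ (truncatedCost M (l + 1)) - valueQ M π z₁.1 z₁.2| := by
          refine (Finset.abs_sum_le_sum_abs _ _).trans_eq (Finset.sum_congr rfl fun z₁ _ => ?_)
          rw [abs_mul, abs_of_nonneg (hP.nonneg _ _)]
      _ ≤ _ := hP.sum_mul_le ih z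
    calc _ ≤ M.γ * ((1 - M.γ)⁻¹ * M.γ ^ (l + 1)) := mul_le_mul_of_nonneg_left this M.γ_pos.le
      _ = _ := by ring

theorem abs_pathExp_omcSingle_self_sub_le (hπ : IsPolicy π) (d : S × A) (l : ℕ) (z : S × A) :
    |pathExp (pairChain M π) d l z (fun ζ => omcSingle M (l + 1) ζ z) - valueQ M π z.1 z.2| ≤
      (1 - M.γ)⁻¹ * hitDiscount (pairChain M π) M.γ z (l + 1) z := by
  have e : pathExp (pairChain M π) d l z (fun ζ => omcSingle M (l + 1) ζ z) =
      pathExp (pairChain M π) d l z (truncatedCost M (l + 1)) :=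
    Finset.sum_congr rfl fun r _ =>
      congrArg (_ * ·) (omcSingle_of_eq M (l + 1) (path d z r) z rfl)
  rw [e]
  simpa [hitDiscount] using abs_pathExp_truncatedCost_sub_le M hπ d l z

/-- Bias of the on-policy Monte Carlo estimate of a single trajectory. -/
theorem abs_pathExp_omcSingle_sub_le (hπ : IsPolicy π) (d : S × A) (l : ℕ) (z₀ z : S × A) :
    |pathExp (pairChain M π) d l z₀ (fun ζ => omcSingle M (l + 1) ζ z) - valueQ M π z.1 z.2| ≤
      (1 - M.γ)⁻¹ * hitDiscount (pairChain M π) M.γ z (l + 1) z₀ := by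
  have hP := isStochastic_pairChain M hπ
  -- At `z` the estimator is the truncated discounted cost. Away from `z` it ignores the first pair,
  -- so its bias averages over the next pair by the recursion that defines `hitDiscount`.
  by_cases hz : z₀ = z
  · subst hz
    exact abs_pathExp_omcSingle_self_sub_le M hπ d l z₀
  induction l generalizing z₀ with
  | zero =>
    rw [pathExp_zero]
    have e : omcSingle M (0 + 1) (path d z₀ (Fin.elim0 : Fin 0 → S × A)) z = 0 := by
      have : path d z₀ (Fin.elim0 : Fin 0 → S × A) = prepend z₀ (fun _ => d) := by
        funext j; cases j <;> simp [path, prepend]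
      rw [this, omcSingle_prepend M _ _ _ _ hz]
      simp [omcSingle]
    have := valueQ_mem M hπ z.1 z.2
    rw [e, zero_sub, abs_neg, abs_of_nonneg this.1]
    simp [hitDiscount, hz, hP.sum_eq_one, this.2]
  | succ l ih =>
    rw [pathExp_succ]
    simp_rw [omcSingle_prepend M _ _ _ _ hz]
    have e : ∑ z₁, pairChain M π z₀ z₁ * pathExp (pairChain M π) d l z₁
        (fun ζ => omcSingle M (l + 1) ζ z) - valueQ M π z.1 z.2 =
        ∑ z₁, pairChain M π z₀ z₁ * (pathExp (pairChain M π) d l z₁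
        (fun ζ => omcSingle M (l + 1) ζ z) - valueQ M π z.1 z.2) := by
      simp_rw [mul_sub, Finset.sum_sub_distrib, ← Finset.sum_mul, hP.sum_eq_one, one_mul]
    rw [e, hitDiscount, if_neg hz, Finset.mul_sum]
    refine (Finset.abs_sum_le_sum_abs _ _).trans (Finset.sum_le_sum fun z₁ _ => ?_)
    rw [abs_mul, abs_of_nonneg (hP.nonneg _ _), mul_left_comm]
    refine mul_le_mul_of_nonneg_left ?_ (hP.nonneg _ _)
    by_cases h1 : z₁ = z
    · subst h1
      exact abs_pathExp_omcSingle_self_sub_le M hπ d l z₁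
    · exact ih z₁ h1

/-- The initial action is prescribed, so the first transition uses `M.P` alone; then come `j` steps
of the state chain and a last draw of the action. -/
theorem pairChain_pow_succ (j : ℕ) (z₀ z : S × A) :
    (pairChain M π ^ (j + 1)) z₀ z =
      ∑ s, M.P z₀.1 z₀.2 s * (stateChain M π ^ j) s z.1 * π z.1 z.2 := by
  induction j generalizing z₀ with
  | zero => simp [pairChain, Matrix.one_apply]
  | succ j ih =>
    rw [pow_succ', Matrix.mul_apply]
    simp_rw [ih]
    rw [Fintype.sum_prod_type]
    refine Finset.sum_congr rfl fun s₁ _ => ?_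
    rw [pow_succ', Matrix.mul_apply]
    simp only [pairChain, stateChain, Finset.mul_sum, Finset.sum_mul]
    rw [Finset.sum_comm]
    exact Finset.sum_congr rfl fun _ _ => Finset.sum_congr rfl fun _ _ => by ring

/-- Once the total deviation from stationarity is at most νmin / 2, every state has mass at least
νmin / 2, and the action then has probability at least τ. The exponent j + 1 is the mixing rate of
`j` state steps. -/
theorem le_pairChain_pow {C ρ νmin τ : ℝ} (hmix : MixesUniformly M π C ρ νmin) (hτ : 0 ≤ τ)
    {j : ℕ} (hj : C * ρ ^ (j + 1) ≤ νmin / 2) (z₀ : S × A) {z : S × A} (hz : τ ≤ π z.1 z.2)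
    (hν : 0 ≤ νmin) : νmin * τ / 2 ≤ (pairChain M π ^ (j + 1)) z₀ z := by
  obtain ⟨ν, -, -, hmix, hmin⟩ := hmix
  have h : ∀ s, νmin / 2 ≤ (stateChain M π ^ j) s z.1 := fun s => by
    have h1 := Finset.single_le_sum (fun s' _ => abs_nonneg ((stateChain M π ^ j) s s' - ν s'))
      (Finset.mem_univ z.1)
    have h2 := (neg_abs_le ((stateChain M π ^ j) s z.1 - ν z.1))
    linarith [hmix s j, hmin z.1]
  rw [pairChain_pow_succ]
  calc νmin * τ / 2 = ∑ s, M.P z₀.1 z₀.2 s * (νmin / 2 * τ) := by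
        rw [← Finset.sum_mul, M.P_sum]; ring
    _ ≤ _ := Finset.sum_le_sum fun s _ => by
        rw [mul_assoc]
        exact mul_le_mul_of_nonneg_left (mul_le_mul (h s) hz hτ
          ((by positivity : (0:ℝ) ≤ νmin / 2).trans (h s))) (M.P_nonneg _ _ _)

end MonteCarlo

end PolicyMD

namespace PolicyMD

/-! ### Concentration of independent bounded variables -/

section Hoeffding

variable {ι : Type*} [Fintype ι] {m : ℕ}

/-- On |x| ≤ 1 one has exp x ≤ 1 + x + x²; centring removes the linear term. -/
theorem sum_mul_exp_le {W X : ι → ℝ} (hW : ∀ i, 0 ≤ W i) (hW1 : ∑ i, W i = 1)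
    (hX : ∑ i, W i * X i = 0) {R c : ℝ} (hR : ∀ i, |X i| ≤ R) (hc : 0 ≤ c) (hcR : c * R ≤ 1) :
    ∑ i, W i * Real.exp (c * X i) ≤ Real.exp (c ^ 2 * R ^ 2) := by
  have h : ∀ i, Real.exp (c * X i) ≤ 1 + c * X i + c ^ 2 * R ^ 2 := fun i => by
    have h1 : |c * X i| ≤ c * R := by
      rw [abs_mul, abs_of_nonneg hc]; exact mul_le_mul_of_nonneg_left (hR i) hc
    have h2 := (abs_le.1 (Real.abs_exp_sub_one_sub_id_le (h1.trans hcR))).2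
    have h3 : (c * X i) ^ 2 ≤ c ^ 2 * R ^ 2 := by
      rw [← sq_abs, ← mul_pow]; exact pow_le_pow_left₀ (abs_nonneg _) h1 2
    linarith
  calc _ ≤ ∑ i, W i * (1 + c * X i + c ^ 2 * R ^ 2) :=
        Finset.sum_le_sum fun i _ => mul_le_mul_of_nonneg_left (h i) (hW i)
    _ = ∑ i, W i + c * ∑ i, W i * X i + c ^ 2 * R ^ 2 * ∑ i, W i := by
        simp only [Finset.mul_sum, ← Finset.sum_add_distrib]
        exact Finset.sum_congr rfl fun i _ => by ring
    _ ≤ _ := by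
        rw [hW1, hX]
        linarith [Real.add_one_le_exp (c ^ 2 * R ^ 2)]

/-- Upper tail of a sum of independent centred bounded variables on finite spaces. -/
theorem sum_prod_upper_tail_le {W X : Fin m → ι → ℝ} (hW : ∀ l i, 0 ≤ W l i)
    (hW1 : ∀ l, ∑ i, W l i = 1) (hX : ∀ l, ∑ i, W l i * X l i = 0) {R e : ℝ}
    (hR : 0 < R) (hXR : ∀ l i, |X l i| ≤ R) (he : 0 ≤ e) (heR : e ≤ 2 * R) :
    ∑ r : Fin m → ι with m * e ≤ ∑ l, X l (r l), ∏ l, W l (r l) ≤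
      Real.exp (-(m * e ^ 2 / (4 * R ^ 2))) := by
  -- This is the minimizer of the Chernoff exponent -c m e + m c² R²; the hypothesis e ≤ 2R is
  -- exactly c R ≤ 1.
  set c := e / (2 * R ^ 2) with hc
  have hc0 : 0 ≤ c := by positivity
  have hcR : c * R ≤ 1 := by
    rw [hc, div_mul_eq_mul_div, div_le_one (by positivity)]
    nlinarith
  calc _ ≤ ∑ r : Fin m → ι with m * e ≤ ∑ l, X l (r l),
        Real.exp (-(c * (m * e))) * ∏ l, W l (r l) * Real.exp (c * X l (r l)) := by
        refine Finset.sum_le_sum fun r hr => ?_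
        have hr := (Finset.mem_filter.1 hr).2
        rw [Finset.prod_mul_distrib, ← Real.exp_sum, ← Finset.mul_sum, mul_left_comm,
          ← Real.exp_add]
        refine le_mul_of_one_le_right (Finset.prod_nonneg fun l _ => hW _ _)
          (Real.one_le_exp ?_)
        linarith [mul_le_mul_of_nonneg_left hr hc0]
    _ ≤ ∑ r : Fin m → ι,
        Real.exp (-(c * (m * e))) * ∏ l, W l (r l) * Real.exp (c * X l (r l)) :=
        Finset.sum_le_sum_of_subset_of_nonneg (Finset.filter_subset _ _) fun r _ _ =>
          mul_nonneg (Real.exp_nonneg _) (Finset.prod_nonneg fun l _ =>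
            mul_nonneg (hW _ _) (Real.exp_nonneg _))
    _ = Real.exp (-(c * (m * e))) * ∏ l, ∑ i, W l i * Real.exp (c * X l i) := by
        rw [← Finset.mul_sum, Finset.prod_univ_sum, Fintype.piFinset_univ]
    _ ≤ Real.exp (-(c * (m * e))) * ∏ _l : Fin m, Real.exp (c ^ 2 * R ^ 2) :=
        mul_le_mul_of_nonneg_left (Finset.prod_le_prod
          (fun l _ => Finset.sum_nonneg fun i _ => mul_nonneg (hW _ _) (Real.exp_nonneg _))
          fun l _ => sum_mul_exp_le (hW l) (hW1 l) (hX l) (hXR l) hc0 hcR) (Real.exp_nonneg _)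
    _ = _ := by
        rw [Finset.prod_const, Finset.card_univ, Fintype.card_fin, ← Real.exp_nat_mul,
          ← Real.exp_add, hc]
        congr 1
        field_simp
        ring

/-- Concentration of the average of independent `[0, R]`-valued variables whose means are within
`b` of `q`. -/
theorem sum_prod_deviation_le (hm : 0 < m) {W f : Fin m → ι → ℝ} (hW : ∀ l i, 0 ≤ W l i)
    (hW1 : ∀ l, ∑ i, W l i = 1) {R b e q : ℝ} (hR : 0 < R) (hf0 : ∀ l i, 0 ≤ f l i)
    (hfR : ∀ l i, f l i ≤ R) (hq : ∀ l, |∑ i, W l i * f l i - q| ≤ b) (he : 0 ≤ e)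
    (heR : e ≤ 2 * R) :
    ∑ r : Fin m → ι with b + e < |1 / (m : ℝ) * ∑ l, f l (r l) - q|, ∏ l, W l (r l) ≤
      2 * Real.exp (-(m * e ^ 2 / (4 * R ^ 2))) := by
  classical
  have hm' : (0 : ℝ) < m := Nat.cast_pos.2 hm
  set a : Fin m → ℝ := fun l => ∑ i, W l i * f l i with ha
  have ha0 : ∀ l, 0 ≤ a l := fun l => Finset.sum_nonneg fun i _ => mul_nonneg (hW _ _) (hf0 _ _)
  have haR : ∀ l, a l ≤ R := fun l => by
    calc a l ≤ ∑ i, W l i * R :=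
          Finset.sum_le_sum fun i _ => mul_le_mul_of_nonneg_left (hfR l i) (hW l i)
      _ = R := by rw [← Finset.sum_mul, hW1, one_mul]
  have h0 : ∀ l, ∑ i, W l i * (f l i - a l) = 0 := fun l => by
    simp_rw [mul_sub, Finset.sum_sub_distrib, ← Finset.sum_mul, hW1, one_mul]
    exact sub_self _
  have h1 := sum_prod_upper_tail_le (X := fun l i => f l i - a l) hW hW1 h0 hR
    (fun l i => abs_le.2 ⟨by linarith [hf0 l i, haR l], by linarith [hfR l i, ha0 l]⟩) he heR
  have h2 := sum_prod_upper_tail_le (X := fun l i => a l - f l i) hW hW1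
    (fun l => by
      rw [← neg_eq_zero, ← h0 l, ← Finset.sum_neg_distrib]
      exact Finset.sum_congr rfl fun i _ => by ring) hR
    (fun l i => abs_le.2 ⟨by linarith [hfR l i, ha0 l], by linarith [hf0 l i, haR l]⟩) he heR
  have hsum : |∑ l, a l - m * q| ≤ m * b := by
    have : ∑ l, a l - m * q = ∑ l, (a l - q) := by simp [Finset.sum_sub_distrib]
    rw [this]
    refine (Finset.abs_sum_le_sum_abs _ _).trans ((Finset.sum_le_sum fun l _ => hq l).trans ?_)
    simp
  -- The means account for at most `b` of the deviation, so the centred sum exceeds `m * e` on one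
  -- of the two sides.
  calc _ ≤ ∑ r ∈ (Finset.univ.filter fun r : Fin m → ι => m * e ≤ ∑ l, (f l (r l) - a l)) ∪
        (Finset.univ.filter fun r : Fin m → ι => m * e ≤ ∑ l, (a l - f l (r l))),
        ∏ l, W l (r l) := by
        refine Finset.sum_le_sum_of_subset_of_nonneg (fun r hr => ?_)
          fun r _ _ => Finset.prod_nonneg fun l _ => hW _ _
        have hr := (Finset.mem_filter.1 hr).2
        have hr' : m * (b + e) < |∑ l, f l (r l) - m * q| := by
          have : ∑ l, f l (r l) - m * q = m * (1 / (m : ℝ) * ∑ l, f l (r l) - q) := by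
            field_simp
          rw [this, abs_mul, abs_of_pos hm']
          exact mul_lt_mul_of_pos_left hr hm'
        rw [Finset.mem_union, Finset.mem_filter, Finset.mem_filter]
        simp only [Finset.mem_univ, true_and, Finset.sum_sub_distrib]
        have := abs_le.1 hsum
        rcases lt_abs.1 hr' with h | h
        · left; linarith
        · right; linarith
    _ ≤ _ := by
        rw [two_mul]
        refine le_trans ?_ (add_le_add h1 h2)
        rw [← Finset.sum_union_inter]
        exact le_add_of_nonneg_right
          (Finset.sum_nonneg fun r _ => Finset.prod_nonneg fun l _ => hW _ _)

end Hoeffding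

/-! ### Conditioning on the past of a run -/

section Sampling

/-- Total probability over a finite-valued `Y`. Subadditivity suffices, so `B` need not be
measurable; the bound is only asked on fibres meeting `B`, where a sample point can supply the
policy. -/
theorem measureReal_le_of_fiber {Ω : Type*} [MeasurableSpace Ω] (ℙ : Measure Ω)
    [IsProbabilityMeasure ℙ] {ι : Type*} [Fintype ι] (Y : Ω → ι)
    (hY : ∀ i, MeasurableSet (Y ⁻¹' {i})) {B : Set Ω} {q : ℝ} (hq : 0 ≤ q)
    (h : ∀ ω₀ ∈ B, ℙ.real (B ∩ Y ⁻¹' {Y ω₀}) ≤ ℙ.real (Y ⁻¹' {Y ω₀}) * q) :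
    ℙ.real B ≤ q := by
  have hB : B = ⋃ i, B ∩ Y ⁻¹' {i} := by
    ext ω; simp
  have h1 : ∑ i, ℙ.real (Y ⁻¹' {i}) = 1 := by
    rw [sum_measureReal_preimage_singleton _ fun i _ => hY i]
    simp
  calc ℙ.real B = ℙ.real (⋃ i, B ∩ Y ⁻¹' {i}) := by rw [← hB]
    _ ≤ ∑ i, ℙ.real (B ∩ Y ⁻¹' {i}) := measureReal_iUnion_fintype_le _
    _ ≤ ∑ i, ℙ.real (Y ⁻¹' {i}) * q := by
        refine Finset.sum_le_sum fun i _ => ?_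
        rcases (B ∩ Y ⁻¹' {i}).eq_empty_or_nonempty with he | ⟨ω₀, hω, hi⟩
        · rw [he, measureReal_empty]
          exact mul_nonneg measureReal_nonneg hq
        · have hi : Y ω₀ = i := hi
          rw [← hi]
          exact h ω₀ hω
    _ = q := by rw [← Finset.sum_mul, h1, one_mul]

variable {S : Type u} {A : Type v} [Fintype S] [Fintype A] [DecidableEq S] [DecidableEq A]
  (M : MDP S A) {wgen : (A → ℝ) → ℝ} {grad : (A → ℝ) → A → ℝ} {η τ : ℝ} {k m n : ℕ}
  {π₀ : S → A → ℝ}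

/-- The policies are adapted: the one at iteration `t` is determined by the samples of earlier
iterations, hence constant on fibres of the past. -/
theorem spmdPolicy_congr {x x' : ℕ → ℕ → ℕ → S × A} {t : ℕ}
    (h : ∀ i < t, ∀ l < m, ∀ j < n, x i l j = x' i l j) :
    spmdPolicy M wgen grad η τ m n π₀ x t = spmdPolicy M wgen grad η τ m n π₀ x' t := by
  induction t with
  | zero => rfl
  | succ t ih =>
    have ih := ih fun i hi => h i (by omega)
    funext s
    simp only [spmdPolicy]
    rw [ih]
    congr 1
    funext a
    simp only [tomc]
    rw [omc_congr M (h t t.lt_succ_self)]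

variable {Ω : Type w} [MeasurableSpace Ω] {ℙ : Measure Ω} [IsProbabilityMeasure ℙ]
  {Z : ℕ → ℕ → ℕ → Ω → S × A}

/-- The samples before iteration `t` and the initial pairs of iteration `t`. -/
def pastSample (m n t : ℕ) (Z : ℕ → ℕ → ℕ → Ω → S × A) (ω : Ω) :
    (Fin t → Fin m → Fin n → S × A) × (Fin m → S × A) :=
  (fun i l j => Z i l j ω, fun l => Z t l 0 ω)

theorem pastSample_eq_iff {t : ℕ} {ω ω₀ : Ω} :
    pastSample m n t Z ω = pastSample m n t Z ω₀ ↔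
      (∀ i < t, ∀ l < m, ∀ j < n, Z i l j ω = Z i l j ω₀) ∧ ∀ l < m, Z t l 0 ω = Z t l 0 ω₀ := by
  simp only [pastSample, Prod.mk.injEq, funext_iff, Fin.forall_iff]

theorem measurableSet_pastSample (h : ∀ t l j z, MeasurableSet {ω | Z t l j ω = z}) (t : ℕ)
    (y : (Fin t → Fin m → Fin n → S × A) × (Fin m → S × A)) :
    MeasurableSet (pastSample m n t Z ⁻¹' {y}) := by
  have : pastSample m n t Z ⁻¹' {y} =
      (⋂ (i : Fin t) (l : Fin m) (j : Fin n), {ω | Z i l j ω = y.1 i l j}) ∩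
        ⋂ l : Fin m, {ω | Z t l 0 ω = y.2 l} := by
    ext ω
    simp [pastSample, Prod.ext_iff, funext_iff]
  rw [this]
  exact (MeasurableSet.iInter fun i => MeasurableSet.iInter fun l =>
    MeasurableSet.iInter fun j => h _ _ _ _).inter (MeasurableSet.iInter fun l => h _ _ _ _)

/-- On a fibre of the past and of the initial pairs, the policy is fixed and the continuations have
a product law, so finite concentration applies. The predicate `G` restricts to policies for which
the bias is controlled. -/
theorem measureReal_deviation_le {L : ℕ}
    (run : IsSPMDRun M wgen grad η τ k m (L + 1) π₀ ℙ Z) (hm : 0 < m) {t : ℕ} (ht : t < k)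
    (z : S × A) {b e : ℝ} (he : 0 ≤ e) (heR : e ≤ 2 * (1 - M.γ)⁻¹) {G : (S → A → ℝ) → Prop}
    (hG : ∀ π, G π → IsPolicy π ∧ ∀ d z₀, |pathExp (pairChain M π) d L z₀
      (fun ζ => omcSingle M (L + 1) ζ z) - valueQ M π z.1 z.2| ≤ b) :
    ℙ.real {ω | G (runPolicy M wgen grad η τ m (L + 1) π₀ Z t ω) ∧
      b + e < |omc M m (L + 1) (fun l j => Z t l j ω) z.1 z.2 -
        valueQ M (runPolicy M wgen grad η τ m (L + 1) π₀ Z t ω) z.1 z.2|} ≤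
      2 * Real.exp (-(m * e ^ 2 / (4 * (1 - M.γ)⁻¹ ^ 2))) := by
  refine measureReal_le_of_fiber ℙ (pastSample m (L + 1) t Z)
    (measurableSet_pastSample run.measurable t) (by positivity) fun ω₀ hω₀ => ?_
  set π := runPolicy M wgen grad η τ m (L + 1) π₀ Z t ω₀ with hπ
  obtain ⟨hpol, hbias⟩ := hG π hω₀.1
  have hP := isStochastic_pairChain M hpol
  set d := Z 0 0 0 ω₀
  -- A sample array with the past of `ω₀` and prescribed continuations `r`, to be fed to the law of
  -- the run. The entries equal to `d` lie outside the sampled range.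
  let x : (Fin m → Fin L → S × A) → ℕ → ℕ → ℕ → S × A := fun r i l j =>
    if i = t then (if h : l < m then path d (Z t l 0 ω₀) (r ⟨l, h⟩) j else d) else Z i l j ω₀
  have hx1 : ∀ r i l j, i < t → x r i l j = Z i l j ω₀ := fun r i l j hi => if_neg hi.ne
  have hx2 : ∀ r l (hl : l < m) j, x r t l j = path d (Z t l 0 ω₀) (r ⟨l, hl⟩) j :=
    fun r l hl j => by simp only [x, if_true, dif_pos hl]
  have hxπ : ∀ r, spmdPolicy M wgen grad η τ m (L + 1) π₀ (x r) t = π := fun r =>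
    spmdPolicy_congr M fun i hi l _ j _ => hx1 r i l j hi
  have hfib : ∀ r, {ω | (∀ i < t, ∀ l < m, ∀ j < L + 1, Z i l j ω = x r i l j) ∧
      ∀ l < m, Z t l 0 ω = x r t l 0} =
      pastSample m (L + 1) t Z ⁻¹' {pastSample m (L + 1) t Z ω₀} := fun r => by
    ext ω
    simp only [Set.mem_preimage, Set.mem_singleton_iff, pastSample_eq_iff, Set.mem_ofPred_eq]
    refine and_congr (forall₂_congr fun i hi => by simp only [hx1 r i _ _ hi])
      (forall₂_congr fun l hl => by rw [hx2 r l hl]; rfl)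
  have hlaw : ∀ r, ℙ.real {ω | (∀ i < t, ∀ l < m, ∀ j < L + 1, Z i l j ω = x r i l j) ∧
      ∀ l < m, ∀ j < L + 1, Z t l j ω = x r t l j} =
      ℙ.real (pastSample m (L + 1) t Z ⁻¹' {pastSample m (L + 1) t Z ω₀}) *
        ∏ l : Fin m, pathWeight (pairChain M π) L (path d (Z t l 0 ω₀) (r l)) := fun r => by
    rw [run.law t ht (x r), hfib r, hxπ r, Finset.prod_range]
    congr 1
    refine Finset.prod_congr rfl fun l _ => Finset.prod_congr rfl fun j _ => ?_
    rw [hx2 r l l.2, hx2 r l l.2]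
  set bad : Finset (Fin m → Fin L → S × A) := Finset.univ.filter fun r =>
    b + e < |1 / (m : ℝ) * ∑ l : Fin m, omcSingle M (L + 1) (path d (Z t l 0 ω₀) (r l)) z -
      valueQ M π z.1 z.2| with hbad
  have hH : ∑ r ∈ bad, ∏ l : Fin m, pathWeight (pairChain M π) L (path d (Z t l 0 ω₀) (r l)) ≤ _ :=
    sum_prod_deviation_le (ι := Fin L → S × A) hm
      (W := fun (l : Fin m) r => pathWeight (pairChain M π) L (path d (Z t l 0 ω₀) r))
      (f := fun (l : Fin m) r => omcSingle M (L + 1) (path d (Z t l 0 ω₀) r) z)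
      (fun l r => pathWeight_nonneg hP _ _) (fun l => sum_pathWeight d hP _ _)
      (inv_pos.2 (sub_pos.2 M.γ_lt_one)) (fun l r => (omcSingle_mem M _ _ _).1)
      (fun l r => (omcSingle_mem M _ _ _).2) (fun l => hbias d _) he heR
  refine le_trans ?_ (mul_le_mul_of_nonneg_left hH measureReal_nonneg)
  rw [Finset.mul_sum, ← Finset.sum_congr rfl fun r _ => hlaw r]
  refine le_trans (measureReal_mono ?_ (measure_ne_top _ _)) (measureReal_biUnion_finset_le _ _)
  rintro ω ⟨⟨-, hdev⟩, hpast⟩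
  have hpast' := pastSample_eq_iff.1 hpast
  have hrun : runPolicy M wgen grad η τ m (L + 1) π₀ Z t ω = π :=
    spmdPolicy_congr M hpast'.1
  rw [hrun] at hdev
  set r : Fin m → Fin L → S × A := fun l j => Z t l (j + 1) ω with hr
  have hcur : ∀ l < m, ∀ j < L + 1, Z t l j ω = x r t l j := fun l hl j hj => by
    rw [hx2 r l hl]
    rcases j with _ | j
    · exact hpast'.2 l hl
    · simp only [path, dif_pos (Nat.lt_of_succ_lt_succ hj), hr]
  refine Set.mem_iUnion₂.2 ⟨r, Finset.mem_filter.2 ⟨Finset.mem_univ _, ?_⟩,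
    fun i hi l hl j hj => (hpast'.1 i hi l hl j hj).trans (hx1 r i l j hi).symm, hcur⟩
  convert hdev using 3
  rw [omc_congr M (ξ' := x r t) hcur]
  simp only [omc]
  rw [Finset.sum_range]
  congr 1
  refine Finset.sum_congr rfl fun l _ => ?_
  congr 1
  funext j
  exact (hx2 r l l.2 j).symm

end Sampling

end PolicyMD

namespace PolicyMD

/-! ### The potential argument along one sample path -/

section Convergence

variable {S : Type u} {A : Type v} [Fintype S] [Fintype A] [DecidableEq S] [DecidableEq A]
  (M : MDP S A) {wgen : (A → ℝ) → ℝ} {grad : (A → ℝ) → A → ℝ} {μ D τD η τ e : ℝ}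

/-- Overestimating `Q` outside the optimal action does not hurt the inner product. -/
theorem sum_sub_mul_sub_le {q u Q v : A → ℝ} (hq : q ∈ stdSimplex ℝ A)
    (hu : u ∈ stdSimplex ℝ A) (he : 0 ≤ e)
    (h : ∀ a, |v a - Q a| ≤ e ∨ (u a = 0 ∧ Q a ≤ v a)) :
    ∑ a, (q a - u a) * Q a ≤ ∑ a, v a * (q a - u a) + 2 * e := by
  have h1 : ∀ a, (q a - u a) * Q a ≤ v a * (q a - u a) + (q a * e + u a * e) := fun a => by
    have hqa := hq.1 a
    have hua := hu.1 a
    rcases h a with h | ⟨h0, hQ⟩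
    · have := abs_le.1 h
      nlinarith
    · rw [h0]
      nlinarith
  refine (Finset.sum_le_sum fun a _ => h1 a).trans_eq ?_
  simp only [Finset.sum_add_distrib, ← Finset.sum_mul]
  rw [hq.2, hu.2]
  ring

theorem mirrorStep_mem (hw : IsDistanceGenerating wgen grad)
    (hdc : DivergenceCondition M wgen grad μ D τD) (hη : 0 ≤ η) {v q : A → ℝ}
    (hq : q ∈ openSimplex A) :
    mirrorStep wgen grad η v q ∈ openSimplex A ∧
      IsMirrorStep wgen grad η v q (mirrorStep wgen grad η v q) := by
  obtain ⟨p, hp, h⟩ := hdc.interior q hq η hη v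
  rw [mirrorStep_spec hw hp h]
  exact ⟨hp, h⟩

theorem isInteriorPolicy_iterate (hw : IsDistanceGenerating wgen grad)
    (hdc : DivergenceCondition M wgen grad μ D τD) (hη : 0 ≤ η) {p v : ℕ → S → A → ℝ}
    (h0 : IsInteriorPolicy (p 0))
    (hp : ∀ t s, p (t + 1) s = mirrorStep wgen grad η (v t s) (p t s)) (t : ℕ) :
    IsInteriorPolicy (p t) := by
  induction t with
  | zero => exact h0
  | succ t ih => exact fun s => by rw [hp]; exact (mirrorStep_mem M hw hdc hη (ih s)).1

/-- Policy mirror descent with truncated gradient estimates: as long as the estimates are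
accurate wherever the policy exceeds `τ`, the accumulated optimality gap is bounded. -/
theorem sum_gap_le (hw : IsDistanceGenerating wgen grad) (hμ : 0 < μ)
    (hdc : DivergenceCondition M wgen grad μ D τD) (hη : 0 ≤ η) (hτ : τ ≤ τD) (he : 0 ≤ e)
    {πopt : S → A → ℝ} (hopt : IsOptimalPolicy M πopt) {α : S → A}
    (hα : IsOptimalSelector M α) {p v : ℕ → S → A → ℝ} (h0 : IsInteriorPolicy (p 0))
    (hp : ∀ t s, p (t + 1) s = mirrorStep wgen grad η (v t s) (p t s))
    (hD : ∀ s, 2 * bregman wgen grad (detPolicy α s) (p 0 s) ≤ D) {k : ℕ}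
    (hv : ∀ t < k, ∀ s a, 0 ≤ v t s a ∧ v t s a ≤ (1 - M.γ)⁻¹)
    (hacc : ∀ t < k, ∀ s a, τ ≤ p t s a → |v t s a - valueQ M (p t) s a| ≤ e)
    (htrunc : ∀ t < k, ∀ s a, ¬ τ ≤ p t s a → v t s a = (1 - M.γ)⁻¹)
    (hbudget : k * (η ^ 2 * (1 - M.γ)⁻¹ ^ 2 / (2 * μ) + 2 * η * e) ≤ D / 2) (s₀ : S) :
    η * (1 - M.γ) * ∑ t ∈ Finset.range k,
      (valueV M (p t) s₀ - valueV M (detPolicy α) s₀) ≤ D := by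
  have hγ : 0 < 1 - M.γ := sub_pos.2 M.γ_lt_one
  have hint := isInteriorPolicy_iterate M hw hdc hη h0 hp
  have hpol : ∀ t, IsPolicy (p t) := fun t s => (hint t s).1
  have hdet := isPolicy_detPolicy α
  have hdopt := IsOptimalSelector.isOptimalPolicy M hopt hα
  have hP := isStochastic_stateChain M hdet
  set N := resolvent M.γ (stateChain M (detPolicy α)) with hN
  have hN0 : ∀ i j, 0 ≤ N i j := resolvent_nonneg hP M.γ_pos
  have hN1 : ∀ i, (1 - M.γ) * ∑ j, N i j = 1 := fun i => by
    rw [hN, sum_resolvent hP M.γ_pos M.γ_lt_one, mul_inv_cancel₀ hγ.ne']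
  set dv : ℕ → S → ℝ := fun t s => bregman wgen grad (detPolicy α s) (p t s) with hdv
  have hdv0 : ∀ t s, 0 ≤ dv t s := fun t s =>
    (by positivity : (0 : ℝ) ≤ _).trans (hdc.strong_convex _ (hdet s) _ (hint t s))
  -- The divergence averaged under the normalized discounted occupancy of the optimal policy, a
  -- probability weight by `hN1`.
  set Φ : ℕ → S → ℝ := fun t s => (1 - M.γ) * ∑ s', N s s' * dv t s' with hΦ
  set B := η ^ 2 * (1 - M.γ)⁻¹ ^ 2 / (2 * μ) + 2 * η * e with hB
  have hB0 : 0 ≤ B := by positivity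
  have hΦdv : ∀ t s, (1 - M.γ) * dv t s ≤ Φ t s := fun t s => by
    refine mul_le_mul_of_nonneg_left ?_ hγ.le
    refine (le_mul_of_one_le_left (hdv0 t s)
      (one_le_resolvent_self hP M.γ_pos M.γ_lt_one s)).trans ?_
    exact Finset.single_le_sum (f := fun s' => N s s' * dv t s')
      (fun s' _ => mul_nonneg (hN0 _ _) (hdv0 _ _)) (Finset.mem_univ s)
  have hΦ0 : ∀ t s, 0 ≤ Φ t s := fun t s =>
    mul_nonneg hγ.le (Finset.sum_nonneg fun s' _ => mul_nonneg (hN0 _ _) (hdv0 _ _))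
  have hstep : ∀ t < k, (∀ s, (1 - M.γ) * dv t s ≤ D) → ∀ s,
      Φ (t + 1) s + η * (1 - M.γ) * (valueV M (p t) s - valueV M (detPolicy α) s) ≤
        Φ t s + B := by
    intro t ht hthr s
    have h1 : ∀ s', η * ∑ a, (p t s' a - detPolicy α s' a) * valueQ M (p t) s' a ≤
        dv t s' - dv (t + 1) s' + B := fun s' => by
      -- The optimal action is not truncated, hence any truncated action has probability zero under
      -- `detPolicy α`.
      have hplay : τ ≤ p t s' (α s') :=
        hτ.trans (hdc.threshold s' (p t) (hint t) α hα (hthr s'))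
      have h2 := sum_sub_mul_sub_le (Q := valueQ M (p t) s') (v := v t s') (hpol t s')
        (hdet s') he (fun a => by
          by_cases ha : τ ≤ p t s' a
          · exact Or.inl (hacc t ht s' a ha)
          · refine Or.inr ⟨?_, ?_⟩
            · have : a ≠ α s' := fun h => ha (h ▸ hplay)
              simp [detPolicy, this]
            · rw [htrunc t ht s' a ha]; exact (valueQ_mem M (hpol t) s' a).2)
      have hm := mirrorStep_mem M hw hdc hη (v := v t s') (hint t s')
      rw [← hp] at hm
      have h3 := mirror_descent_step hw hμ hη hdc.strong_convex (hint t s') hm.1 hm.2 (hdet s')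
        (fun a => abs_le.2 ⟨by linarith [(hv t ht s' a).1, (hv t ht s' a).2],
          (hv t ht s' a).2⟩)
      have h4 := mul_le_mul_of_nonneg_left h2 hη
      simp only [hdv, hB]
      linarith
    have h5 : (1 - M.γ) * ∑ s', N s s' *
        (η * ∑ a, (p t s' a - detPolicy α s' a) * valueQ M (p t) s' a) ≤
        (1 - M.γ) * ∑ s', N s s' * (dv t s' - dv (t + 1) s' + B) :=
      mul_le_mul_of_nonneg_left (Finset.sum_le_sum fun s' _ =>
        mul_le_mul_of_nonneg_left (h1 s') (hN0 s s')) hγ.le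
    have h6 : (1 - M.γ) * ∑ s', N s s' * (dv t s' - dv (t + 1) s' + B) =
        Φ t s - Φ (t + 1) s + B := by
      have : B = (1 - M.γ) * (∑ s', N s s') * B := by rw [hN1, one_mul]
      conv_rhs => rw [this]
      simp only [hΦ, mul_add, mul_sub, Finset.sum_add_distrib, Finset.sum_sub_distrib,
        ← Finset.sum_mul]
      ring
    have h7 : η * (1 - M.γ) * (valueV M (p t) s - valueV M (detPolicy α) s) =
        (1 - M.γ) * ∑ s', N s s' *
        (η * ∑ a, (p t s' a - detPolicy α s' a) * valueQ M (p t) s' a) := by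
      rw [valueV_sub_valueV M (hpol t) hdet, mul_comm η, mul_assoc, Finset.mul_sum]
      congr 1
      exact Finset.sum_congr rfl fun s' _ => by rw [hN]; ring
    linarith
  have hmain : ∀ t ≤ k, ∀ s, Φ t s + η * (1 - M.γ) * ∑ i ∈ Finset.range t,
      (valueV M (p i) s - valueV M (detPolicy α) s) ≤ D / 2 + t * B := by
    intro t
    induction t with
    | zero =>
      intro _ s
      have : Φ 0 s ≤ (1 - M.γ) * ∑ s', N s s' * (D / 2) :=
        mul_le_mul_of_nonneg_left (Finset.sum_le_sum fun s' _ =>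
          mul_le_mul_of_nonneg_left (by have := hD s'; simp only [hdv]; linarith) (hN0 s s')) hγ.le
      rw [← Finset.sum_mul, ← mul_assoc, hN1] at this
      simp
      linarith
    | succ t ih =>
      intro ht s
      have ih := ih (by omega)
      -- The past gaps are nonnegative by optimality, so they can be dropped from the induction
      -- hypothesis: Φ_t ≤ D/2 + tB ≤ D. This is where the budget must hold for all `k` steps
      -- together.
      have hthr : ∀ s, (1 - M.γ) * dv t s ≤ D := fun s => by
        have h1 : 0 ≤ η * (1 - M.γ) * ∑ i ∈ Finset.range t,
            (valueV M (p i) s - valueV M (detPolicy α) s) :=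
          mul_nonneg (mul_nonneg hη hγ.le)
            (Finset.sum_nonneg fun i _ => sub_nonneg.2 (hdopt.2 (p i) (hpol i) s))
        have h2 : (t : ℝ) * B ≤ k * B :=
          mul_le_mul_of_nonneg_right (Nat.cast_le.2 (by omega)) hB0
        linarith [ih s, hΦdv t s]
      have h3 := hstep t (by omega) hthr s
      rw [Finset.sum_range_succ, mul_add]
      push_cast
      linarith [ih s]
  linarith [hmain k le_rfl s₀, hΦ0 k s₀]

/-- The optimality gap of the best iterate. -/
theorem bestValue_gap_le (hw : IsDistanceGenerating wgen grad) (hμ : 0 < μ)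
    (hdc : DivergenceCondition M wgen grad μ D τD) (hη : 0 ≤ η) (hτ : τ ≤ τD) (he : 0 ≤ e)
    {πopt : S → A → ℝ} (hopt : IsOptimalPolicy M πopt) {α : S → A}
    (hα : IsOptimalSelector M α) {p v : ℕ → S → A → ℝ} (h0 : IsInteriorPolicy (p 0))
    (hp : ∀ t s, p (t + 1) s = mirrorStep wgen grad η (v t s) (p t s))
    (hD : ∀ s, 2 * bregman wgen grad (detPolicy α s) (p 0 s) ≤ D) {k : ℕ} (hk : 0 < k)
    (hv : ∀ t < k, ∀ s a, 0 ≤ v t s a ∧ v t s a ≤ (1 - M.γ)⁻¹)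
    (hacc : ∀ t < k, ∀ s a, τ ≤ p t s a → |v t s a - valueQ M (p t) s a| ≤ e)
    (htrunc : ∀ t < k, ∀ s a, ¬ τ ≤ p t s a → v t s a = (1 - M.γ)⁻¹)
    (hbudget : k * (η ^ 2 * (1 - M.γ)⁻¹ ^ 2 / (2 * μ) + 2 * η * e) ≤ D / 2)
    {θ : S → ℝ} (hθ : θ ∈ stdSimplex ℝ S) :
    η * (1 - M.γ) * (k * (bestValue M θ k hk p - objective M θ πopt)) ≤ D := by
  have hγ : 0 < 1 - M.γ := sub_pos.2 M.γ_lt_one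
  have hobj := objective_le M θ hθ (IsOptimalSelector.isOptimalPolicy M hopt hα) hopt.1
  have h1 : k * (bestValue M θ k hk p - objective M θ πopt) ≤
      ∑ t ∈ Finset.range k, (objective M θ (p t) - objective M θ (detPolicy α)) := by
    calc _ = ∑ _t ∈ Finset.range k, (bestValue M θ k hk p - objective M θ πopt) := by
          simp [mul_sub]
      _ ≤ _ := Finset.sum_le_sum fun t ht => sub_le_sub (Finset.inf'_le _ ht) hobj
  have h2 : η * (1 - M.γ) * ∑ t ∈ Finset.range k,
      (objective M θ (p t) - objective M θ (detPolicy α)) =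
      ∑ s, θ s * (η * (1 - M.γ) * ∑ t ∈ Finset.range k,
        (valueV M (p t) s - valueV M (detPolicy α) s)) := by
    simp only [objective, ← Finset.sum_sub_distrib, ← mul_sub]
    rw [Finset.sum_comm, Finset.mul_sum]
    refine Finset.sum_congr rfl fun s _ => ?_
    rw [← Finset.mul_sum]; ring
  calc _ ≤ _ := mul_le_mul_of_nonneg_left h1 (mul_nonneg hη hγ.le)
    _ = _ := h2
    _ ≤ ∑ s, θ s * D := Finset.sum_le_sum fun s _ => mul_le_mul_of_nonneg_left
        (sum_gap_le M hw hμ hdc hη hτ he hopt hα h0 hp hD hv hacc htrunc hbudget s) (hθ.1 s)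
    _ = D := by rw [← Finset.sum_mul, hθ.2, one_mul]

end Convergence

/-! ### Trajectory length needed for a small bias -/

section Bias

theorem ceil_logb_pos {C ρ q : ℝ} (hC : 1 ≤ C) (hρ0 : 0 < ρ) (hρ1 : ρ < 1) (hq0 : 0 < q)
    (hq1 : q ≤ 1) : 0 < ⌈Real.logb ρ (q / (2 * C))⌉ :=
  Int.ceil_pos.2 (Real.logb_pos_of_base_lt_one hρ0 hρ1 (by positivity)
    (by rw [div_lt_one (by positivity)]; linarith))

theorem le_mixFactor {γ C ρ νmin τ : ℝ} (hC : 1 ≤ C) (hρ0 : 0 < ρ) (hρ1 : ρ < 1)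
    (hq0 : 0 < νmin * τ) (hq1 : νmin * τ ≤ 1) :
    1 / (1 - γ) ≤ mixFactor γ C ρ νmin τ := by
  have : (0 : ℝ) < (⌈Real.logb ρ (νmin * τ / (2 * C))⌉ : ℝ) :=
    Int.cast_pos.2 (ceil_logb_pos hC hρ0 hρ1 hq0 hq1)
  unfold mixFactor
  have := div_pos this hq0
  linarith

theorem log_sixteen_le : Real.log 16 ≤ 3 := by
  have : (16 : ℝ) = 2 ^ 4 := by norm_num
  rw [this, Real.log_pow]
  push_cast
  linarith [Real.log_two_lt_d9]

theorem one_le_log_of_le {x : ℝ} (hx : 6 ≤ x) : 1 ≤ Real.log x := by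
  rw [Real.le_log_iff_exp_le (by linarith)]
  linarith [Real.exp_one_lt_d9]

variable {S : Type u} {A : Type v} [Fintype S] [Fintype A] [DecidableEq S] [DecidableEq A]
  (M : MDP S A) {π : S → A → ℝ}

theorem hitDiscount_le_of_nScale_le (hπ : IsPolicy π) {C ρ νmin τ : ℝ}
    (hmix : MixesUniformly M π C ρ νmin) (hC : 1 ≤ C) (hρ0 : 0 < ρ) (hρ1 : ρ < 1)
    (hν0 : 0 < νmin) (hν1 : νmin ≤ 1) (hτ0 : 0 < τ) (hτ1 : τ ≤ 1) {a ε : ℝ} (ha : 1 ≤ a)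
    (hε0 : 0 < ε) (hε1 : ε ≤ 1 / 6) {n : ℕ}
    (hn : 24 * nScale (mixFactor M.γ C ρ νmin τ) a ε ≤ n) (z₀ : S × A) {z : S × A}
    (hz : τ ≤ π z.1 z.2) :
    (1 - M.γ)⁻¹ * hitDiscount (pairChain M π) M.γ z n z₀ ≤ ε / 8 := by
  have hP := isStochastic_pairChain M hπ
  have hγ : 0 < 1 - M.γ := sub_pos.2 M.γ_lt_one
  set R := (1 - M.γ)⁻¹ with hR
  have hR1 : 1 ≤ R := (one_le_inv₀ hγ).2 (by linarith [M.γ_pos])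
  have hR0 : 0 < R := by linarith
  set q := νmin * τ with hq
  have hq0 : 0 < q := mul_pos hν0 hτ0
  have hq1 : q ≤ 1 := mul_le_one₀ hν1 hτ0.le hτ1
  have hRH := le_mixFactor (γ := M.γ) hC hρ0 hρ1 hq0 hq1
  have hceil := ceil_logb_pos hC hρ0 hρ1 hq0 hq1
  obtain ⟨j, hj⟩ : ∃ j : ℕ, ⌈Real.logb ρ (q / (2 * C))⌉ = ((j + 1 : ℕ) : ℤ) := by
    obtain ⟨i, hi⟩ := Int.eq_ofNat_of_zero_le hceil.le
    exact ⟨i - 1, by omega⟩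
  have hH : mixFactor M.γ C ρ νmin τ = R + (j + 1) / q := by
    unfold mixFactor
    rw [← hq, hj, one_div]
    push_cast
    rfl
  rw [one_div, ← hR] at hRH
  set H := mixFactor M.γ C ρ νmin τ
  have hmixj : C * ρ ^ (j + 1) ≤ νmin / 2 := by
    have h1 : Real.logb ρ (q / (2 * C)) ≤ ((j + 1 : ℕ) : ℝ) := by
      have := Int.le_ceil (Real.logb ρ (q / (2 * C)))
      rw [hj] at this
      exact_mod_cast this
    have h2 : ρ ^ (j + 1) ≤ q / (2 * C) := by
      rw [← Real.rpow_natCast]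
      calc ρ ^ ((j + 1 : ℕ) : ℝ) ≤ ρ ^ Real.logb ρ (q / (2 * C)) :=
            Real.rpow_le_rpow_of_exponent_ge hρ0 hρ1.le h1
        _ = _ := Real.rpow_logb hρ0 hρ1.ne (by positivity)
    calc C * ρ ^ (j + 1) ≤ C * (q / (2 * C)) := mul_le_mul_of_nonneg_left h2 (by linarith)
      _ = q / 2 := by field_simp
      _ ≤ νmin / 2 := by nlinarith
  -- With j + 1 the rounded-up mixing time, each block of j + 2 times visits `z` with probability at
  -- least q/2.
  have hsurv : ∀ z₀, survival (pairChain M π) z (j + 2) z₀ ≤ 1 - q / 2 := fun z₀ =>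
    (survival_le_one_sub z hP (j + 1) z₀).trans
      (sub_le_sub_left (le_pairChain_pow M hmix hτ0.le hmixj z₀ hz hν0.le) 1)
  -- Two terms of size exp(-Λ) = ε/(16R), multiplied by R, make ε/8. One comes from the discount
  -- after the visit, the other from a missed visit.
  set Λ := Real.log (16 * R / ε) with hΛ
  have hΛ1 : 1 ≤ Λ := one_le_log_of_le (by rw [le_div_iff₀ hε0]; nlinarith)
  have hΛH : 6 * Λ * H ≤ n := by
    refine le_trans ?_ hn
    have hℓ : 1 ≤ Real.log (a / ε) := one_le_log_of_le (by rw [le_div_iff₀ hε0]; nlinarith)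
    have hh : 0 ≤ Real.log H := Real.log_nonneg (hR1.trans hRH)
    have h1 : Λ ≤ 3 + Real.log H + Real.log (a / ε) := by
      rw [hΛ, mul_div_assoc, Real.log_mul (by norm_num) (by positivity), div_eq_mul_inv,
        Real.log_mul hR0.ne' (by positivity)]
      have h2 := Real.log_le_log hR0 hRH
      have h3 : Real.log ε⁻¹ ≤ Real.log (a / ε) :=
        Real.log_le_log (by positivity) (by
          rw [div_eq_mul_inv]; exact le_mul_of_one_le_left (by positivity) ha)
      linarith [log_sixteen_le]
    -- Both factors on the right are at least 1, so the sum of logarithms is bounded by their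
    -- product; with 6ΛH ≤ n this explains the constant 24 = 6 · 4.
    have h4 : Λ ≤ 4 * (Real.log (a / ε) * (1 + Real.log H)) := by nlinarith
    unfold nScale
    have := mul_le_mul_of_nonneg_left h4 (hR0.le.trans hRH)
    linarith
  -- The number of blocks for which (1 - q/2)^i ≤ exp(-Λ). They take at most 6Λ(j+1)/q steps,
  -- leaving at least ΛR steps for the discount.
  set i := ⌈2 * Λ / q⌉₊ with hi
  have hi1 : 2 * Λ / q ≤ i := Nat.le_ceil _
  have hi2 : (i : ℝ) ≤ 3 * Λ / q := by
    have h1 : (i : ℝ) < 2 * Λ / q + 1 := Nat.ceil_lt_add_one (by positivity)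
    have h2 : 1 ≤ Λ / q := by rw [le_div_iff₀ hq0]; linarith
    have h3 : 3 * Λ / q = 2 * Λ / q + Λ / q := by ring
    linarith
  have hiB : ((i * (j + 2) : ℕ) : ℝ) ≤ 6 * Λ * ((j + 1) / q) := by
    push_cast
    calc (i : ℝ) * (j + 2) ≤ (3 * Λ / q) * (2 * (j + 1)) :=
          mul_le_mul hi2 (by linarith [(Nat.cast_nonneg j : (0 : ℝ) ≤ j)]) (by positivity)
            (by positivity)
      _ = _ := by ring
  have hsplit : ((i * (j + 2) : ℕ) : ℝ) + Λ * R ≤ n := by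
    rw [hH] at hΛH
    nlinarith
  have hle : i * (j + 2) ≤ n := by
    have : ((i * (j + 2) : ℕ) : ℝ) ≤ n := by nlinarith
    exact_mod_cast this
  obtain ⟨N, rfl⟩ := Nat.exists_eq_add_of_le' hle
  have hN : Λ * R ≤ N := by
    rw [Nat.cast_add] at hsplit
    linarith
  have hexp : Real.exp (-Λ) = ε / (16 * R) := by
    rw [Real.exp_neg, hΛ, Real.exp_log (by positivity), inv_div]
  have h1 : M.γ ^ N ≤ ε / (16 * R) := by
    have h2 : M.γ ≤ Real.exp (-(1 - M.γ)) := by linarith [Real.add_one_le_exp (-(1 - M.γ))]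
    rw [← hexp]
    refine (pow_le_pow_left₀ M.γ_pos.le h2 N).trans ?_
    rw [← Real.exp_nat_mul, Real.exp_le_exp]
    have h3 : Λ * R * (1 - M.γ) = Λ := by rw [hR, mul_assoc, inv_mul_cancel₀ hγ.ne', mul_one]
    nlinarith
  have h2 : (1 - q / 2) ^ i ≤ ε / (16 * R) := by
    have h2 : 1 - q / 2 ≤ Real.exp (-(q / 2)) := by linarith [Real.add_one_le_exp (-(q / 2))]
    rw [← hexp]
    refine (pow_le_pow_left₀ (by linarith) h2 i).trans ?_
    rw [← Real.exp_nat_mul, Real.exp_le_exp]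
    rw [div_le_iff₀ hq0] at hi1
    linarith
  have h3 := (hitDiscount_le z hP M.γ_pos M.γ_lt_one N (i * (j + 2)) z₀).trans
    (add_le_add_right (survival_mul_le z hP (by linarith) hsurv i z₀) _)
  calc R * hitDiscount (pairChain M π) M.γ z (N + i * (j + 2)) z₀
      ≤ R * (ε / (16 * R) + ε / (16 * R)) := mul_le_mul_of_nonneg_left (by linarith) hR0.le
    _ = ε / 8 := by field_simp; ring

end Bias

end PolicyMD

namespace PolicyMD

/-! ### Union bound and the high-probability gap -/

section HighProbability

variable {S : Type u} {A : Type v} [Fintype S] [Fintype A] [DecidableEq S] [DecidableEq A]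
  [Nonempty S] [Nonempty A] (M : MDP S A) {wgen : (A → ℝ) → ℝ} {grad : (A → ℝ) → A → ℝ}
  {Ω : Type w} [MeasurableSpace Ω] {ℙ : Measure Ω} [IsProbabilityMeasure ℙ]
  {Z : ℕ → ℕ → ℕ → Ω → S × A}

theorem one_sub_le_measureReal {E B : Set Ω} {δ : ℝ} (h : Eᶜ ⊆ B) (hB : ℙ.real B ≤ δ) :
    1 - δ ≤ ℙ.real E := by
  have h1 : ℙ.real Set.univ ≤ ℙ.real E + ℙ.real B := by
    refine (measureReal_mono ?_ (measure_ne_top _ _)).trans (measureReal_union_le E B)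
    intro ω _
    by_cases hω : ω ∈ E
    · exact Or.inl hω
    · exact Or.inr (h hω)
  rw [probReal_univ] at h1
  linarith

/-- With high probability all estimates above the threshold are accurate. -/
theorem measureReal_exists_inaccurate_le {η τ : ℝ} {k m L : ℕ} {π₀ : S → A → ℝ}
    (run : IsSPMDRun M wgen grad η τ k m (L + 1) π₀ ℙ Z) (hk : 0 < k) (hm : 0 < m)
    {C ρ νmin δ ε : ℝ} (hδ : 0 < δ) (hε0 : 0 < ε) (hε1 : ε ≤ 1 / 6)
    (hpol : ∀ t ω, IsPolicy (runPolicy M wgen grad η τ m (L + 1) π₀ Z t ω))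
    (hmix : ∀ t < k, ∀ᵐ ω ∂ℙ,
      MixesUniformly M (runPolicy M wgen grad η τ m (L + 1) π₀ Z t ω) C ρ νmin)
    (hC : 1 ≤ C) (hρ0 : 0 < ρ) (hρ1 : ρ < 1) (hν0 : 0 < νmin) (hν1 : νmin ≤ 1)
    (hτ0 : 0 < τ) (hτ1 : τ ≤ 1)
    (hmS : 256 * mScale M.γ (Fintype.card A) (Fintype.card (S × A)) k δ ε ≤ m)
    (hnS : 24 * nScale (mixFactor M.γ C ρ νmin τ) (Fintype.card A) ε ≤ (L + 1 : ℕ)) :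
    ℙ.real {ω | ∃ t < k, ∃ z : S × A,
      τ ≤ runPolicy M wgen grad η τ m (L + 1) π₀ Z t ω z.1 z.2 ∧
      ε / 4 < |omc M m (L + 1) (fun l j => Z t l j ω) z.1 z.2 -
        valueQ M (runPolicy M wgen grad η τ m (L + 1) π₀ Z t ω) z.1 z.2|} ≤ δ := by
  have hγ : 0 < 1 - M.γ := sub_pos.2 M.γ_lt_one
  have hR1 : 1 ≤ (1 - M.γ)⁻¹ := (one_le_inv₀ hγ).2 (by linarith [M.γ_pos])
  have ha : (1 : ℝ) ≤ Fintype.card A := by exact_mod_cast Fintype.card_pos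
  have hz : (0 : ℝ) < Fintype.card (S × A) := by exact_mod_cast Fintype.card_pos
  have hk' : (0 : ℝ) < k := Nat.cast_pos.2 hk
  set nZ : ℝ := (Fintype.card (S × A) : ℝ) with hnZ
  set pol := runPolicy M wgen grad η τ m (L + 1) π₀ Z with hpoldef
  let bad : ℕ → S × A → Set Ω := fun t z => {ω |
    (IsPolicy (pol t ω) ∧ MixesUniformly M (pol t ω) C ρ νmin ∧ τ ≤ pol t ω z.1 z.2) ∧
    ε / 8 + ε / 8 < |omc M m (L + 1) (fun l j => Z t l j ω) z.1 z.2 -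
      valueQ M (pol t ω) z.1 z.2|}
  -- Mixing holds only almost surely; the exceptional paths are collected in a null set.
  let nomix : Set Ω := {ω | ¬ ∀ t ∈ Finset.range k, MixesUniformly M (pol t ω) C ρ νmin}
  have hnomix : ℙ.real nomix = 0 := by
    have : ∀ᵐ ω ∂ℙ, ∀ t ∈ Finset.range k, MixesUniformly M (pol t ω) C ρ νmin :=
      (Finset.eventually_all _).2 fun t ht => hmix t (Finset.mem_range.1 ht)
    rw [measureReal_def, ae_iff.1 this, ENNReal.toReal_zero]
  have hexp : 2 * Real.exp (-(m * (ε / 8) ^ 2 / (4 * (1 - M.γ)⁻¹ ^ 2))) ≤ δ / (nZ * k) := by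
    -- Here the logarithm may be negative, but the claimed bound is at least 2 and hence trivial.
    by_cases hsmall : 2 * nZ * k / δ ≤ 1
    · have h1 : Real.exp (-(m * (ε / 8) ^ 2 / (4 * (1 - M.γ)⁻¹ ^ 2))) ≤ 1 :=
        Real.exp_le_one_iff.2 (neg_nonpos.2 (by positivity))
      rw [le_div_iff₀ (by positivity)]
      rw [div_le_one hδ] at hsmall
      nlinarith [mul_pos hz hk']
    · have hlog : 0 ≤ Real.log (2 * nZ * k / δ) := Real.log_nonneg (not_le.1 hsmall).le
      have h1 : Real.log (2 * nZ * k / δ) ≤ m * (ε / 8) ^ 2 / (4 * (1 - M.γ)⁻¹ ^ 2) := by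
        -- 256 = 4 · 8², from the deviation ε/8 in the Chernoff exponent; the factor |A|² ≥ 1 is
        -- dropped.
        have h2 : 256 * (1 / ((1 - M.γ) ^ 2 * ε ^ 2) * Real.log (2 * nZ * k / δ)) ≤ m := by
          refine le_trans ?_ hmS
          unfold mScale
          gcongr
          exact one_le_pow₀ ha
        rw [← mul_assoc, mul_one_div, div_mul_eq_mul_div, div_le_iff₀ (by positivity)] at h2
        rw [le_div_iff₀ (by positivity), inv_pow, ← mul_assoc, ← div_eq_mul_inv,
          div_le_iff₀ (by positivity)]
        linarith
      calc _ ≤ 2 * Real.exp (-Real.log (2 * nZ * k / δ)) := by gcongr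
        _ = δ / (nZ * k) := by
            rw [Real.exp_neg, Real.exp_log (by positivity)]
            field_simp
  have hbad : ∀ t ∈ Finset.range k, ∀ z, ℙ.real (bad t z) ≤ δ / (nZ * k) := fun t ht z =>
    (measureReal_deviation_le M run hm (Finset.mem_range.1 ht) z (b := ε / 8) (e := ε / 8)
      (G := fun π => IsPolicy π ∧ MixesUniformly M π C ρ νmin ∧ τ ≤ π z.1 z.2)
      (by positivity) (by linarith) fun π hπ => ⟨hπ.1, fun d z₀ =>
        (abs_pathExp_omcSingle_sub_le M hπ.1 d L z₀ z).trans
          (hitDiscount_le_of_nScale_le M hπ.1 hπ.2.1 hC hρ0 hρ1 hν0 hν1 hτ0 hτ1 ha hε0 hε1 hnS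
            z₀ hπ.2.2)⟩).trans hexp
  have hsub : {ω | ∃ t < k, ∃ z : S × A, τ ≤ pol t ω z.1 z.2 ∧
      ε / 4 < |omc M m (L + 1) (fun l j => Z t l j ω) z.1 z.2 -
        valueQ M (pol t ω) z.1 z.2|} ⊆
      nomix ∪ ⋃ t ∈ Finset.range k, ⋃ z ∈ Finset.univ, bad t z := by
    rintro ω ⟨t, ht, z, hτz, hdev⟩
    by_cases hω : ω ∈ nomix
    · exact Or.inl hω
    · have ht' := Finset.mem_range.2 ht
      refine Or.inr (Set.mem_iUnion₂.2 ⟨t, ht', Set.mem_iUnion₂.2 ⟨z, Finset.mem_univ _,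
        ⟨hpol t ω, not_not.1 hω t ht', hτz⟩, ?_⟩⟩)
      convert hdev using 1
      ring
  calc _ ≤ ℙ.real (nomix ∪ ⋃ t ∈ Finset.range k, ⋃ z ∈ Finset.univ, bad t z) :=
        measureReal_mono hsub (measure_ne_top _ _)
    _ ≤ ℙ.real nomix + ℙ.real (⋃ t ∈ Finset.range k, ⋃ z ∈ Finset.univ, bad t z) :=
        measureReal_union_le _ _
    _ ≤ 0 + ∑ t ∈ Finset.range k, ∑ z : S × A, ℙ.real (bad t z) := by
        rw [hnomix]
        refine add_le_add_right ((measureReal_biUnion_finset_le _ _).trans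
          (Finset.sum_le_sum fun t _ => measureReal_biUnion_finset_le _ _)) _
    _ ≤ ∑ _t ∈ Finset.range k, ∑ _z : S × A, δ / (nZ * k) := by
        rw [zero_add]
        exact Finset.sum_le_sum fun t ht => Finset.sum_le_sum fun z _ => hbad t ht z
    _ = δ := by
        simp only [Finset.sum_const, Finset.card_range, Finset.card_univ, nsmul_eq_mul]
        rw [← hnZ]
        field_simp

theorem tomc_mem {m : ℕ} (hm : 0 < m) (n : ℕ) (τ : ℝ) (π : S → A → ℝ) (ξ : ℕ → ℕ → S × A)
    (s : S) (a : A) : 0 ≤ tomc M m n τ π ξ s a ∧ tomc M m n τ π ξ s a ≤ (1 - M.γ)⁻¹ := by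
  unfold tomc
  split_ifs
  · exact omc_mem M hm n ξ s a
  · rw [one_div]
    exact ⟨inv_nonneg.2 (sub_pos.2 M.γ_lt_one).le, le_rfl⟩

theorem high_probability_gap {μ D τD C ρ νmin δ : ℝ} {π₀ : S → A → ℝ} {θ : S → ℝ}
    {πopt : S → A → ℝ} (hw : IsDistanceGenerating wgen grad) (hμ : 0 < μ) (hD : 0 < D)
    (hdc : DivergenceCondition M wgen grad μ D τD) (h0 : IsInteriorPolicy π₀)
    (hinit : ∀ α : S → A, IsOptimalSelector M α → ∀ s,
      2 * bregman wgen grad (detPolicy α s) (π₀ s) ≤ D)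
    (hC : 1 ≤ C) (hρ0 : 0 < ρ) (hρ1 : ρ < 1) (hν0 : 0 < νmin) (hν1 : νmin ≤ 1) (hδ : 0 < δ)
    (hθ : θ ∈ stdSimplex ℝ S) (hopt : IsOptimalPolicy M πopt) {R τ η ε : ℝ}
    (hR : R = 1 / (1 - M.γ)) (hτ : τ = min τD (1 / (Fintype.card A : ℝ))) {k m n : ℕ}
    (hη : η = 1 / 2 * Real.sqrt (D * μ / (k * R ^ 2)))
    (hε : ε = R / 2 * Real.sqrt (D / (μ * k))) (hk : 0 < k) (hm : 0 < m) (hn : 0 < n)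
    (hmS : 256 * mScale M.γ (Fintype.card A) (Fintype.card (S × A)) k δ ε ≤ m)
    (hnS : 256 * nScale (mixFactor M.γ C ρ νmin τ) (Fintype.card A) ε ≤ n)
    (run : IsSPMDRun M wgen grad η τ k m n π₀ ℙ Z)
    (hmix : ∀ t < k, ∀ᵐ ω ∂ℙ,
      MixesUniformly M (runPolicy M wgen grad η τ m n π₀ Z t ω) C ρ νmin) :
    1 - δ ≤ ℙ.real {ω | bestValue M θ k hk
      (fun t => runPolicy M wgen grad η τ m n π₀ Z t ω) - objective M θ πopt ≤
        3 * R / (1 - M.γ) * Real.sqrt (D / (μ * k))} := by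
  have hγ : 0 < 1 - M.γ := sub_pos.2 M.γ_lt_one
  have hk' : (0 : ℝ) < k := Nat.cast_pos.2 hk
  have hR' : R = (1 - M.γ)⁻¹ := by rw [hR, one_div]
  have hR0 : 0 < R := by rw [hR']; exact inv_pos.2 hγ
  have hR1 : 1 ≤ R := by rw [hR']; exact (one_le_inv₀ hγ).2 (by linarith [M.γ_pos])
  have ha : (1 : ℝ) ≤ Fintype.card A := by exact_mod_cast Fintype.card_pos
  set σ := Real.sqrt (D / (μ * k)) with hσ
  have hσ0 : 0 < σ := Real.sqrt_pos.2 (by positivity)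
  have hσ2 : σ ^ 2 * (μ * k) = D := by
    rw [hσ, Real.sq_sqrt (by positivity)]; field_simp
  have hησ : η = 1 / 2 * (μ * σ / R) := by
    rw [hη]
    congr 1
    rw [Real.sqrt_eq_iff_mul_self_eq (by positivity) (by positivity), ← hσ2]
    field_simp
  have hη0 : 0 ≤ η := by rw [hησ]; positivity
  have hε0 : 0 < ε := by rw [hε]; positivity
  have hpol : ∀ t ω, IsInteriorPolicy (runPolicy M wgen grad η τ m n π₀ Z t ω) := fun t ω =>
    isInteriorPolicy_iterate M hw hdc hη0
      (p := fun t => runPolicy M wgen grad η τ m n π₀ Z t ω)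
      (v := fun t s => tomc M m n τ (runPolicy M wgen grad η τ m n π₀ Z t ω)
        (fun l j => Z t l j ω) s) h0 (fun _ _ => rfl) t
  -- For ε > 1/6 the asserted bound equals 6Rε, which exceeds R, the largest possible cost.
  -- Otherwise |A|/ε ≥ 6 > e, so the logarithms are at least 1.
  by_cases hlarge : 1 / 6 < ε
  · refine one_sub_le_measureReal (B := ∅) ?_ (by simpa using hδ.le)
    intro ω hω
    refine hω ?_
    have h1 : bestValue M θ k hk (fun t => runPolicy M wgen grad η τ m n π₀ Z t ω) ≤ R := by
      refine (Finset.inf'_le _ (Finset.mem_range.2 hk)).trans ?_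
      rw [hR']
      exact (objective_mem M hθ fun s => (hpol 0 ω s).1).2
    have h2 := (objective_mem M hθ hopt.1).1
    have h3 : 3 * R / (1 - M.γ) * σ = 6 * R * ε := by
      rw [hε, div_eq_mul_inv, ← hR']; ring
    refine (sub_le_self _ h2).trans (h1.trans ?_)
    rw [h3]
    nlinarith
  · have hε1 : ε ≤ 1 / 6 := not_lt.1 hlarge
    have hτ0 : 0 < τ := by rw [hτ]; exact lt_min hdc.threshold_pos (by positivity)
    have hτ1 : τ ≤ 1 := by
      rw [hτ]
      exact (min_le_right _ _).trans ((div_le_one (by linarith)).2 ha)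
    obtain ⟨L, rfl⟩ := Nat.exists_eq_succ_of_ne_zero hn.ne'
    have hnS' : 24 * nScale (mixFactor M.γ C ρ νmin τ) (Fintype.card A) ε ≤ (L + 1 : ℕ) := by
      refine le_trans ?_ hnS
      refine mul_le_mul_of_nonneg_right (by norm_num) ?_
      have hRH := le_mixFactor (γ := M.γ) hC hρ0 hρ1 (mul_pos hν0 hτ0) (mul_le_one₀ hν1 hτ0.le hτ1)
      rw [← hR] at hRH
      have h1 : 0 ≤ Real.log (mixFactor M.γ C ρ νmin τ) := Real.log_nonneg (hR1.trans hRH)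
      have h2 : 1 ≤ Real.log (Fintype.card A / ε) :=
        one_le_log_of_le (by rw [le_div_iff₀ hε0]; nlinarith)
      unfold nScale
      have := hR0.le.trans hRH
      positivity
    refine one_sub_le_measureReal ?_ (measureReal_exists_inaccurate_le M run hk hm hδ hε0 hε1
      (fun t ω s => (hpol t ω s).1) hmix hC hρ0 hρ1 hν0 hν1 hτ0 hτ1 hmS hnS')
    intro ω hω
    by_contra hgood
    refine hω ?_
    have hgood' : ∀ t < k, ∀ z : S × A,
        τ ≤ runPolicy M wgen grad η τ m (L + 1) π₀ Z t ω z.1 z.2 →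
        |omc M m (L + 1) (fun l j => Z t l j ω) z.1 z.2 -
          valueQ M (runPolicy M wgen grad η τ m (L + 1) π₀ Z t ω) z.1 z.2| ≤ ε / 4 := by
      intro t ht z hz
      by_contra h
      exact hgood ⟨t, ht, z, hz, not_le.1 h⟩
    obtain ⟨α, hα⟩ := exists_isOptimalSelector M
    have hgap := bestValue_gap_le M (τ := τ) (e := ε / 4) hw hμ hdc hη0
      (hτ.trans_le (min_le_left _ _)) (by positivity) hopt hα
      (p := fun t => runPolicy M wgen grad η τ m (L + 1) π₀ Z t ω)
      (v := fun t s => tomc M m (L + 1) τ (runPolicy M wgen grad η τ m (L + 1) π₀ Z t ω)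
        (fun l j => Z t l j ω) s) h0 (fun _ _ => rfl) (hinit α hα) hk
      (fun t _ s a => tomc_mem M hm _ _ _ _ s a)
      (fun t ht s a h => by
        simp only [tomc, if_pos h]
        exact hgood' t ht (s, a) h)
      (fun t ht s a h => by simp only [tomc, if_neg h, one_div])
      (by
        rw [← hR', hησ, hε, ← hσ2]
        -- The step-size error and the estimation error each contribute μσ²/8 per iteration; over
        -- `k` iterations this is D/4, within the budget D/2.
        have h1 : (1 / 2 * (μ * σ / R)) ^ 2 * R ^ 2 / (2 * μ) +
            2 * (1 / 2 * (μ * σ / R)) * (R / 2 * σ / 4) = μ * σ ^ 2 / 4 := by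
          field_simp; ring
        rw [h1]
        have : 0 ≤ μ * σ ^ 2 * k := by positivity
        linarith) hθ
    set gap := bestValue M θ k hk (fun t => runPolicy M wgen grad η τ m (L + 1) π₀ Z t ω) -
      objective M θ πopt
    change gap ≤ _
    have h1 : η * (1 - M.γ) * (k * gap) = (μ * k * σ * (1 - M.γ) / (2 * R)) * gap := by
      rw [hησ]; field_simp
    rw [h1] at hgap
    have hpos : 0 < μ * k * σ * (1 - M.γ) / (2 * R) := by positivity
    refine le_of_mul_le_mul_left (hgap.trans ?_) hpos
    -- In these units the asserted bound is worth 3D/2, whereas the potential argument gives D.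
    have h2 : μ * k * σ * (1 - M.γ) / (2 * R) * (3 * R / (1 - M.γ) * σ) =
        3 / 2 * (σ ^ 2 * (μ * k)) := by field_simp
    rw [h2, hσ2]
    linarith

end HighProbability

/-! ### Arithmetic of the sample count -/

section SampleComplexity

/-- Solving for `D` in terms of the real iteration count `x`, with k between x and 2x, pins σ to the
order g²ε and the estimation accuracy to the order gε. The rational lower constant 2/9 is below
1/√18, the value at k = 2x. -/
theorem acc_bounds {g D μ ε x k σ : ℝ} (hg0 : 0 < g) (hμ : 0 < μ)
    (hε0 : 0 < ε) (hεR : ε ≤ 1 / g) (hD : D = μ * g ^ 4 * ε ^ 2 * x / 9) (hx : 0 < x)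
    (hkx : x ≤ k) (hk2 : k ≤ 2 * x) (hσ : σ = Real.sqrt (D / (μ * k))) :
    3 * (1 / g) / g * σ ≤ ε ∧ 1 / g / 2 * σ ≤ 1 / 6 ∧ g * ε / 9 ≤ 1 / g / 2 * σ := by
  have hk0 : 0 < k := by linarith
  have hσ0 : 0 ≤ σ := hσ ▸ Real.sqrt_nonneg _
  have hσ2 : σ ^ 2 * k = g ^ 4 * ε ^ 2 * x / 9 := by
    rw [hσ, Real.sq_sqrt (by rw [hD]; positivity), hD]; field_simp
  have hσu : σ ≤ g ^ 2 * ε / 3 := by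
    refine (sq_le_sq₀ hσ0 (by positivity)).1 (le_of_mul_le_mul_right ?_ hk0)
    rw [hσ2]
    have : (g ^ 2 * ε / 3) ^ 2 * k = g ^ 4 * ε ^ 2 / 9 * k := by ring
    rw [this]
    have := mul_le_mul_of_nonneg_left hkx (by positivity : 0 ≤ g ^ 4 * ε ^ 2 / 9)
    linarith
  have hσl : g ^ 2 * ε * 2 / 9 ≤ σ := by
    refine (sq_le_sq₀ (by positivity) hσ0).1 (le_of_mul_le_mul_right ?_ hk0)
    rw [hσ2]
    have h1 : (g ^ 2 * ε * 2 / 9) ^ 2 * k = g ^ 4 * ε ^ 2 * 4 / 81 * k := by ring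
    rw [h1]
    have := mul_le_mul_of_nonneg_left hk2 (by positivity : 0 ≤ g ^ 4 * ε ^ 2 * 4 / 81)
    have : 0 ≤ g ^ 4 * ε ^ 2 * x := by positivity
    linarith
  refine ⟨?_, ?_, ?_⟩
  · calc 3 * (1 / g) / g * σ ≤ 3 * (1 / g) / g * (g ^ 2 * ε / 3) :=
          mul_le_mul_of_nonneg_left hσu (by positivity)
      _ = ε := by field_simp
  · have h1 := mul_le_mul_of_nonneg_left hσu (by positivity : 0 ≤ 1 / g / 2)
    have h2 : 1 / g / 2 * (g ^ 2 * ε / 3) = g * ε / 6 := by field_simp; ring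
    have h3 := mul_le_mul_of_nonneg_left hεR hg0.le
    rw [mul_one_div_cancel hg0.ne'] at h3
    linarith
  · have h1 := mul_le_mul_of_nonneg_left hσl (by positivity : 0 ≤ 1 / g / 2)
    have h2 : 1 / g / 2 * (g ^ 2 * ε * 2 / 9) = g * ε / 9 := by field_simp
    linarith

/-- The accuracy is at least (1-γ)ε/9, giving the factor 81; replacing k by x costs another factor 2
in the logarithm, whence 162. The lower bound makes later rounding to integers harmless. -/
theorem mScale_bounds {γ a z k δ ε acc x : ℝ} (hγ0 : 0 < γ) (hγ1 : γ < 1) (ha : 1 ≤ a)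
    (hz : 1 ≤ z) (hδ0 : 0 < δ) (hδ1 : δ < 1) (hε0 : 0 < ε) (hx : 1 ≤ x) (hkx : x ≤ k)
    (hk2 : k ≤ 2 * x) (hacc1 : acc ≤ 1 / 6) (hacc : (1 - γ) * ε / 9 ≤ acc) :
    1 / 2 ≤ mScale γ a z k δ acc ∧ mScale γ a z k δ acc ≤
      162 * (a ^ 2 / ((1 - γ) ^ 4 * ε ^ 2) * Real.log (2 * z * x / δ)) := by
  have hg0 : 0 < 1 - γ := by linarith
  have hacc0 : 0 < acc := lt_of_lt_of_le (by positivity) hacc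
  have h2x : 2 ≤ 2 * z * x / δ := by
    rw [le_div_iff₀ hδ0]
    nlinarith [one_le_mul_of_one_le_of_one_le hz hx]
  have hxk : 2 * z * x / δ ≤ 2 * z * k / δ :=
    div_le_div_of_nonneg_right (mul_le_mul_of_nonneg_left hkx (by linarith)) hδ0.le
  have hlog2 := Real.log_le_log (by norm_num) h2x
  have hlogk : Real.log (2 * z * k / δ) ≤ 2 * Real.log (2 * z * x / δ) := by
    have h1 : 2 * z * k / δ ≤ 2 * (2 * z * x / δ) := by
      rw [← mul_div_assoc]
      refine div_le_div_of_nonneg_right ?_ hδ0.le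
      linarith [mul_le_mul_of_nonneg_left hk2 (by linarith : 0 ≤ 2 * z)]
    have h2 := Real.log_le_log (by linarith) h1
    rw [Real.log_mul (by norm_num) (by linarith)] at h2
    linarith
  have hlogk1 : 1 / 2 ≤ Real.log (2 * z * k / δ) := by
    have := Real.log_le_log (by norm_num) (h2x.trans hxk)
    linarith [Real.log_two_gt_d9]
  unfold mScale
  constructor
  · have h1 : 1 ≤ a ^ 2 / ((1 - γ) ^ 2 * acc ^ 2) := by
      rw [one_le_div (by positivity)]
      have h2 : (1 - γ) ^ 2 * acc ^ 2 ≤ 1 := mul_le_one₀ (pow_le_one₀ hg0.le (by linarith))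
        (by positivity) (pow_le_one₀ hacc0.le (by linarith))
      linarith [one_le_pow₀ ha (n := 2)]
    exact hlogk1.trans (le_mul_of_one_le_left (by linarith) h1)
  · calc a ^ 2 / ((1 - γ) ^ 2 * acc ^ 2) * Real.log (2 * z * k / δ)
        ≤ a ^ 2 / ((1 - γ) ^ 2 * ((1 - γ) * ε / 9) ^ 2) * (2 * Real.log (2 * z * x / δ)) := by
          refine mul_le_mul ?_ hlogk (by linarith) (by positivity)
          gcongr
      _ = _ := by field_simp; ring

theorem nScale_bounds {γ H a ε acc : ℝ} (hγ0 : 0 < γ) (hγ1 : γ < 1) (hRH : 1 / (1 - γ) ≤ H)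
    (ha : 1 ≤ a) (hε0 : 0 < ε) (hacc1 : acc ≤ 1 / 6) (hacc : (1 - γ) * ε / 9 ≤ acc) :
    1 ≤ nScale H a acc ∧ nScale H a acc ≤
      4 * (H * max 1 (Real.log (a / ε)) * (1 + Real.log H) ^ 2) := by
  have hg0 : 0 < 1 - γ := by linarith
  have hacc0 : 0 < acc := lt_of_lt_of_le (by positivity) hacc
  have hR1 : 1 ≤ 1 / (1 - γ) := (one_le_div hg0).2 (by linarith)
  have hH1 := hR1.trans hRH
  have hh : 0 ≤ Real.log H := Real.log_nonneg hH1
  have hlog1 : 1 ≤ Real.log (a / acc) :=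
    one_le_log_of_le (by rw [le_div_iff₀ hacc0]; linarith)
  unfold nScale
  refine ⟨one_le_mul_of_one_le_of_one_le (one_le_mul_of_one_le_of_one_le hH1 hlog1)
    (by linarith), ?_⟩
  have h4 := Real.log_le_log (by positivity) hRH
  set h := Real.log H
  set ℓ := max 1 (Real.log (a / ε))
  have hℓ1 : 1 ≤ ℓ := le_max_left _ _
  have h1 : Real.log (a / acc) ≤ 4 * (ℓ * (1 + h)) := by
    -- The natural constant 9 is enlarged to 16 to reuse `log_sixteen_le`; the factor 1/(1-γ) is
    -- absorbed into log H.
    have h2 : a / acc ≤ 16 * (1 / (1 - γ)) * (a / ε) := by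
      calc a / acc ≤ a / ((1 - γ) * ε / 9) := by gcongr
        _ = 9 * (1 / (1 - γ)) * (a / ε) := by field_simp
        _ ≤ 16 * (1 / (1 - γ)) * (a / ε) := by gcongr; norm_num
    have h3 := Real.log_le_log (by positivity) h2
    rw [Real.log_mul (by positivity) (by positivity),
      Real.log_mul (by norm_num) (by positivity)] at h3
    have h5 : Real.log (a / ε) ≤ ℓ := le_max_right _ _
    nlinarith [log_sixteen_le]
  calc H * Real.log (a / acc) * (1 + h) ≤ H * (4 * (ℓ * (1 + h))) * (1 + h) :=
        mul_le_mul_of_nonneg_right (mul_le_mul_of_nonneg_left h1 (by linarith)) (by linarith)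
    _ = _ := by ring

theorem natCast_le_of_le_ceil {y : ℝ} {i : ℕ} (hy : 1 ≤ y) (hi : i ≤ ⌈y⌉₊) :
    (i : ℝ) ≤ 2 * y := by
  have h1 := Nat.ceil_lt_add_one (by linarith : (0 : ℝ) ≤ y)
  have h2 : (i : ℝ) ≤ (⌈y⌉₊ : ℝ) := Nat.cast_le.2 hi
  linarith

theorem sampleBound_eq {γ H a z D μ δ ε : ℝ} (hγ1 : γ < 1) (hμ : 0 < μ) (hδ0 : 0 < δ)
    (hε0 : 0 < ε) : sampleBound γ H a z D μ δ ε =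
      D / (μ * (1 - γ) ^ 4 * ε ^ 2) * (a ^ 2 / ((1 - γ) ^ 4 * ε ^ 2) * Real.log (2 * z *
        (9 * (1 / (1 - γ)) ^ 2 * D / (μ * (1 - γ) ^ 2 * ε ^ 2)) / δ)) *
        (H * max 1 (Real.log (a / ε)) * (1 + Real.log H) ^ 2) := by
  have hg0 : 1 - γ ≠ 0 := by linarith
  have h1 : 2 * z * (9 * (1 / (1 - γ)) ^ 2 * D / (μ * (1 - γ) ^ 2 * ε ^ 2)) / δ =
      18 * z * (1 / (1 - γ)) ^ 2 * D / (δ * (1 - γ) ^ 2 * μ * ε ^ 2) := by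
    field_simp; ring
  have h2 : D * a ^ 2 / ((1 - γ) ^ 8 * μ * ε ^ 4) =
      D / (μ * (1 - γ) ^ 4 * ε ^ 2) * (a ^ 2 / ((1 - γ) ^ 4 * ε ^ 2)) := by
    field_simp
  rw [sampleBound, h1, h2]
  ring

/-- The arithmetic behind the sample complexity bound. -/
theorem sample_count_le {γ H a z D μ δ ε c₁ : ℝ} {k m n : ℕ} (hγ0 : 0 < γ) (hγ1 : γ < 1)
    (hRH : 1 / (1 - γ) ≤ H) (ha : 1 ≤ a) (hz : 1 ≤ z) (hμ : 0 < μ) (hδ0 : 0 < δ)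
    (hδ1 : δ < 1) (hc₁ : 256 ≤ c₁) (hε0 : 0 < ε) (hεR : ε ≤ 1 / (1 - γ))
    (hx : 1 ≤ 9 * (1 / (1 - γ)) ^ 2 * D / (μ * (1 - γ) ^ 2 * ε ^ 2))
    (hk : k = ⌈9 * (1 / (1 - γ)) ^ 2 * D / (μ * (1 - γ) ^ 2 * ε ^ 2)⌉₊) {acc : ℝ}
    (hacc : acc = 1 / (1 - γ) / 2 * Real.sqrt (D / (μ * k)))
    (hm : m ≤ ⌈c₁ * mScale γ a z k δ acc⌉₊) (hn : n ≤ ⌈c₁ * nScale H a acc⌉₊) :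
    3 * (1 / (1 - γ)) / (1 - γ) * Real.sqrt (D / (μ * k)) ≤ ε ∧
      0 < mScale γ a z k δ acc ∧ 0 < nScale H a acc ∧
      ((k * m * n : ℕ) : ℝ) ≤ 46656 * c₁ ^ 2 * sampleBound γ H a z D μ δ ε := by
  have hg0 : 0 < 1 - γ := by linarith
  rw [sampleBound_eq hγ1 hμ hδ0 hε0]
  have hk4 : 2 * (9 * (1 / (1 - γ)) ^ 2 * D / (μ * (1 - γ) ^ 2 * ε ^ 2)) =
      18 * (D / (μ * (1 - γ) ^ 4 * ε ^ 2)) := by field_simp; ring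
  have hDx : D = μ * (1 - γ) ^ 4 * ε ^ 2 *
      (9 * (1 / (1 - γ)) ^ 2 * D / (μ * (1 - γ) ^ 2 * ε ^ 2)) / 9 := by field_simp
  generalize 9 * (1 / (1 - γ)) ^ 2 * D / (μ * (1 - γ) ^ 2 * ε ^ 2) = x at *
  have hkx : x ≤ k := by rw [hk]; exact Nat.le_ceil _
  have hk2 : (k : ℝ) ≤ 2 * x := by
    have := Nat.ceil_lt_add_one (by linarith : 0 ≤ x)
    rw [← hk] at this
    linarith
  obtain ⟨h1, h2, h3⟩ := acc_bounds hg0 hμ hε0 hεR hDx (by linarith) hkx hk2 rfl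
  rw [← hacc] at h2 h3
  obtain ⟨hm1, hm2⟩ := mScale_bounds hγ0 hγ1 ha hz hδ0 hδ1 hε0 hx hkx hk2 h2 h3
  obtain ⟨hn1, hn2⟩ := nScale_bounds hγ0 hγ1 hRH ha hε0 h2 h3
  refine ⟨h1, by linarith, by linarith, ?_⟩
  have hm3 := natCast_le_of_le_ceil (by nlinarith) hm
  have hn3 := natCast_le_of_le_ceil (by nlinarith) hn
  have hm4 := mul_le_mul_of_nonneg_left hm2 (by linarith : 0 ≤ 2 * c₁)
  have hn4 := mul_le_mul_of_nonneg_left hn2 (by linarith : 0 ≤ 2 * c₁)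
  rw [hk4] at hk2
  push_cast
  generalize a ^ 2 / ((1 - γ) ^ 4 * ε ^ 2) * Real.log (2 * z * x / δ) = X at *
  generalize H * max 1 (Real.log (a / ε)) * (1 + Real.log H) ^ 2 = Y at *
  generalize D / (μ * (1 - γ) ^ 4 * ε ^ 2) = W at *
  have hk0 : (0 : ℝ) ≤ k := k.cast_nonneg
  have hm0 : (0 : ℝ) ≤ m := m.cast_nonneg
  have hn0 : (0 : ℝ) ≤ n := n.cast_nonneg
  have hm5 : (m : ℝ) ≤ 324 * c₁ * X := by linarith
  have hn5 : (n : ℝ) ≤ 8 * c₁ * Y := by linarith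
  -- The numerical constant is 18 · 324 · 8 = 46656, where 324 and 8 double the scale constants 162
  -- and 4 because of rounding up.
  calc (k : ℝ) * m * n ≤ 18 * W * (324 * c₁ * X) * (8 * c₁ * Y) :=
        mul_le_mul (mul_le_mul hk2 hm5 hm0 (hk0.trans hk2)) hn5 hn0
          (mul_nonneg (hk0.trans hk2) (hm0.trans hm5))
    _ = _ := by ring

end SampleComplexity

end PolicyMD

/-! ### The main theorem -/

theorem mainTheorem5 :
    ∃ c₀ : ℝ, 0 < c₀ ∧ ∀ c₁ : ℝ, c₀ ≤ c₁ → ∃ K : ℝ, 0 < K ∧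
    ∀ (S : Type u) (A : Type v) [Fintype S] [Fintype A] [DecidableEq S] [DecidableEq A]
      [Nonempty S] [Nonempty A] (M : PolicyMD.MDP S A)
      (wgen : (A → ℝ) → ℝ) (grad : (A → ℝ) → A → ℝ) (μ D τD C ρ νmin δ : ℝ)
      (π₀ : S → A → ℝ) (θ : S → ℝ) (πopt : S → A → ℝ),
      PolicyMD.IsDistanceGenerating wgen grad →
      0 < μ → 0 < D →
      PolicyMD.DivergenceCondition M wgen grad μ D τD →
      PolicyMD.IsInteriorPolicy π₀ →
      (∀ α : S → A, PolicyMD.IsOptimalSelector M α → ∀ s,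
        2 * PolicyMD.bregman wgen grad (PolicyMD.detPolicy α s) (π₀ s) ≤ D) →
      1 ≤ C → 0 < ρ → ρ < 1 → 0 < νmin → νmin ≤ 1 →
      0 < δ → δ < 1 →
      θ ∈ stdSimplex ℝ S →
      PolicyMD.IsOptimalPolicy M πopt →
      let R : ℝ := 1 / (1 - M.γ)
      let nA : ℝ := (Fintype.card A : ℝ)
      let nZ : ℝ := (Fintype.card (S × A) : ℝ)
      let τ : ℝ := min τD (1 / nA)
      let H : ℝ := PolicyMD.mixFactor M.γ C ρ νmin τ
      let stepsize : ℕ → ℝ := fun k => 1 / 2 * Real.sqrt (D * μ / (k * R ^ 2))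
      let acc : ℕ → ℝ := fun k => R / 2 * Real.sqrt (D / (μ * k))
      -- high-probability bound on the best-iterate optimality gap
      (∀ (k m n : ℕ) (hk : 0 < k), 0 < m → 0 < n →
        c₀ * PolicyMD.mScale M.γ nA nZ k δ (acc k) ≤ m →
        c₀ * PolicyMD.nScale H nA (acc k) ≤ n →
        ∀ (Ω : Type w) [MeasurableSpace Ω] (ℙ : MeasureTheory.Measure Ω)
          [MeasureTheory.IsProbabilityMeasure ℙ] (Z : ℕ → ℕ → ℕ → Ω → S × A),
          PolicyMD.IsSPMDRun M wgen grad (stepsize k) τ k m n π₀ ℙ Z →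
          (∀ t < k, ∀ᵐ ω ∂ℙ, PolicyMD.MixesUniformly M
            (PolicyMD.runPolicy M wgen grad (stepsize k) τ m n π₀ Z t ω) C ρ νmin) →
          1 - δ ≤ ℙ.real {ω |
            PolicyMD.bestValue M θ k hk
              (fun t => PolicyMD.runPolicy M wgen grad (stepsize k) τ m n π₀ Z t ω)
              - PolicyMD.objective M θ πopt
              ≤ 3 * R / (1 - M.γ) * Real.sqrt (D / (μ * k))}) ∧
      -- sample complexity for a target accuracy
      (∀ ε : ℝ, 0 < ε → ε ≤ R → 1 ≤ 9 * R ^ 2 * D / (μ * (1 - M.γ) ^ 2 * ε ^ 2) →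
        ∀ (k m n : ℕ) (hk : 0 < k),
        k = ⌈9 * R ^ 2 * D / (μ * (1 - M.γ) ^ 2 * ε ^ 2)⌉₊ →
        c₀ * PolicyMD.mScale M.γ nA nZ k δ (acc k) ≤ m →
        m ≤ ⌈c₁ * PolicyMD.mScale M.γ nA nZ k δ (acc k)⌉₊ →
        c₀ * PolicyMD.nScale H nA (acc k) ≤ n →
        n ≤ ⌈c₁ * PolicyMD.nScale H nA (acc k)⌉₊ →
        ((k * m * n : ℕ) : ℝ) ≤ K * PolicyMD.sampleBound M.γ H nA nZ D μ δ ε ∧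
        ∀ (Ω : Type w) [MeasurableSpace Ω] (ℙ : MeasureTheory.Measure Ω)
          [MeasureTheory.IsProbabilityMeasure ℙ] (Z : ℕ → ℕ → ℕ → Ω → S × A),
          PolicyMD.IsSPMDRun M wgen grad (stepsize k) τ k m n π₀ ℙ Z →
          (∀ t < k, ∀ᵐ ω ∂ℙ, PolicyMD.MixesUniformly M
            (PolicyMD.runPolicy M wgen grad (stepsize k) τ m n π₀ Z t ω) C ρ νmin) →
          1 - δ ≤ ℙ.real {ω |
            PolicyMD.bestValue M θ k hk
              (fun t => PolicyMD.runPolicy M wgen grad (stepsize k) τ m n π₀ Z t ω)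
              - PolicyMD.objective M θ πopt ≤ ε}) := by
  refine ⟨256, by norm_num, fun c₁ hc₁ => ⟨46656 * c₁ ^ 2, by positivity, ?_⟩⟩
  intro S A _ _ _ _ _ _ M wgen grad μ D τD C ρ νmin δ π₀ θ πopt hw hμ hD hdc h0 hinit hC hρ0
    hρ1 hν0 hν1 hδ0 hδ1 hθ hopt R nA nZ τ H stepsize acc
  have hnA : (1 : ℝ) ≤ nA := Nat.one_le_cast.2 Fintype.card_pos
  have hnZ : (1 : ℝ) ≤ nZ := Nat.one_le_cast.2 Fintype.card_pos
  have hτ0 : 0 < τ := lt_min hdc.threshold_pos (by positivity)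
  have hτ1 : τ ≤ 1 := (min_le_right _ _).trans ((div_le_one (by linarith)).2 hnA)
  have hRH : R ≤ H := PolicyMD.le_mixFactor hC hρ0 hρ1 (mul_pos hν0 hτ0)
    (mul_le_one₀ hν1 hτ0.le hτ1)
  refine ⟨fun k m n hk hm hn hmS hnS Ω _ ℙ _ Z run hmix =>
    PolicyMD.high_probability_gap M hw hμ hD hdc h0 hinit hC hρ0 hρ1 hν0 hν1 hδ0 hθ hopt rfl rfl
      rfl rfl hk hm hn hmS hnS run hmix, ?_⟩
  intro ε hε0 hεR hx k m n hk hkx hmS hmS' hnS hnS'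
  obtain ⟨hgap, hm, hn, hcount⟩ := PolicyMD.sample_count_le M.γ_pos M.γ_lt_one hRH hnA hnZ hμ hδ0
    hδ1 hc₁ hε0 hεR hx hkx rfl hmS' hnS'
  refine ⟨hcount, fun Ω _ ℙ _ Z run hmix => ?_⟩
  -- Positivity of `m` and `n` is not assumed in the second claim; it follows from the positive
  -- scales, which rest on the accuracy being at most 1/6 when ε ≤ 1/(1-γ).
  have hm0 : 0 < m := Nat.cast_pos.1 ((by positivity : (0 : ℝ) < _).trans_le hmS)
  have hn0 : 0 < n := Nat.cast_pos.1 ((by positivity : (0 : ℝ) < _).trans_le hnS)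
  refine (PolicyMD.high_probability_gap M hw hμ hD hdc h0 hinit hC hρ0 hρ1 hν0 hν1 hδ0 hθ hopt
    rfl rfl rfl rfl hk hm0 hn0 hmS hnS run hmix).trans
    (MeasureTheory.measureReal_mono (fun ω hω => ?_) (MeasureTheory.measure_ne_top _ _))
  exact le_trans hω hgap
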